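/- **Setting.** Let $\phi$ be the standard normal density and $M_q=E|Z|^q$ for $Z\sim N(0,1)$. An eligible model consists of $\varepsilon\in(0,1)$, $u_0\in\mathbb R$, $\sigma_0>0$ and a probability distribution $H$ of pairs $(u,\sigma)$ such that the marginal distribution of $\sigma$ is supported on $[\sigma_0,\infty)$ and, for every $\sigma\ge\sigma_0$, the conditional distribution of $u$ given $\sigma$ has a density $h(\cdot|\sigma)$. Its observations $X_1,\dots,X_n$ are i.i.d. with density $$f(x)=(1-\varepsilon)\frac1{\sigma_0}\phi\Big(\frac{x-u_0}{\sigma_0}\Big)+\varepsilon\int\frac1\sigma\phi\Big(\frac{x-u}{\sigma}\Big)\,dH(u,\sigma).$$ Write $\hat h(t|\sigma)=\int e^{itu}h(u|\sigma)\,du$ and $\tilde h(t|\sigma)=\int e^{itu}h(u+u_0|\sigma)\,du$. Given $\alpha,\varepsilon_0,q,a,A$ and $\eta_n$, let $\mathcal F'_0(\eta_n)$ be the class of eligible models with $$\sigma_0\ge a,\qquad \int|x|^qf(x)\,dx\le A^q,\qquad \eta_n\le\varepsilon\le\varepsilon_0,$$ $$\limsup_{t\to\infty}\sup_{\sigma\ge\sigma_0}|t|^\alpha|\hat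 h(t|\sigma)|\le A,\qquad \limsup_{t\to\infty}\sup_{\sigma\ge\sigma_0}|t|^{\alpha+1}|\tilde h'(t|\sigma)|\le A,$$ where $\tilde h'(t|\sigma)$, the derivative in $t$, is required to exist for all sufficiently large $t$ and all $\sigma\ge\sigma_0$. Define the minimax risks $$R_n^\sigma(\eta_n)=\inf_{T}\sup_{\mathcal F'_0(\eta_n)}E\big[(T-\sigma_0^2)^2\big],\qquad R_n^u(\eta_n)=\inf_{T}\sup_{\mathcal F'_0(\eta_n)}E\big[(T-u_0)^2\big],$$ where $T$ ranges over all real-valued measurable functions of $(X_1,\dots,X_n)$. **Corollary 2.1.** Fix $\alpha>2$, $\beta\in[0,1/2)$, $\varepsilon_0\in(0,1)$, $q>0$, $a>0$ and $A>\sqrt{a^2+1}\,M_q^{1/q}$. There is a constant $C>0$, depending only on $\alpha,\beta,\varepsilon_0,q,a,A$, such that for every sequence $(\eta_n)_{n\ge1}$ with $\varepsilon_0n^{-\beta}\le\eta_n\le\varepsilon_0$ for all $n\ge1$, $$\liminf_{n\to\infty}\ \eta_n^{-2}(\log n)^{\alpha+2}R_n^\sigma(\eta_n)\ge C\qquad\text{and}\qquad\liminf_{n\to\infty}\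 \eta_n^{-2}(\log n)^{\alpha+1}R_n^u(\eta_n)\ge C.$$ -/

import Mathlib

open MeasureTheory ProbabilityTheory Filter Set
open scoped ENNReal Topology

noncomputable section

namespace NullDensity

/-- The density `x ↦ σ⁻¹ φ((x - u)/σ)` of `N(u, σ²)`, where `φ` is the standard normal density. -/
def normalDensity (u σ x : ℝ) : ℝ := (1 / σ) * gaussianPDFReal 0 1 ((x - u) / σ)

/-- `M_q = E|X|^q` for `X ∼ N(0,1)`. -/
def normalAbsMoment (q : ℝ) : ℝ := ∫ x, |x| ^ q ∂(gaussianReal 0 1)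

/-- An eligible Gaussian mixture model: a proportion `ε` of nonnull effects, null parameters
`u0` and `σ0`, a mixing distribution `H` of pairs `(u, σ)` whose `σ`-marginal is supported on
`[σ0, ∞)`, and a conditional density `h σ u = h(u|σ)` of `u` given `σ`, for every `σ ≥ σ0`. -/
structure EligibleModel where
  ε : ℝ
  u0 : ℝ
  σ0 : ℝ
  H : Measure (ℝ × ℝ)
  h : ℝ → ℝ → ℝ
  ε_pos : 0 < ε
  ε_lt_one : ε < 1
  σ0_pos : 0 < σ0
  prob_H : IsProbabilityMeasure H
  supp_H : (H.map Prod.snd) (Iio σ0) = 0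
  meas_h : Measurable (Function.uncurry h)
  h_nonneg : ∀ σ, σ0 ≤ σ → ∀ u, 0 ≤ h σ u
  h_integral : ∀ σ, σ0 ≤ σ → ∫⁻ u, ENNReal.ofReal (h σ u) = 1
  /-- `dH(u, σ) = h(u|σ) du dH(σ)`, i.e. `h(·|σ)` is the density of the conditional law of `u`
  given `σ`. -/
  disint : H = ((volume : Measure ℝ).prod (H.map Prod.snd)).withDensity
    (fun p => ENNReal.ofReal (h p.2 p.1))

namespace EligibleModel

/-- The marginal density of each observation,
`f(x) = (1-ε) σ0⁻¹ φ((x-u0)/σ0) + ε ∫ σ⁻¹ φ((x-u)/σ) dH(u,σ)`. -/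
def density (θ : EligibleModel) (x : ℝ) : ℝ :=
  (1 - θ.ε) * normalDensity θ.u0 θ.σ0 x + θ.ε * ∫ p, normalDensity p.1 p.2 x ∂θ.H

/-- The law of a single observation. -/
def law (θ : EligibleModel) : Measure ℝ :=
  volume.withDensity (fun x => ENNReal.ofReal (θ.density x))

/-- The joint law of the i.i.d. sample `X_1, …, X_n`. -/
def sampleLaw (θ : EligibleModel) (n : ℕ) : Measure (Fin n → ℝ) :=
  Measure.pi (fun _ => θ.law)

/-- The characteristic function `ĥ(t|σ)` of the conditional density `h(·|σ)`. -/
def hHat (θ : EligibleModel) (σ t : ℝ) : ℂ :=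
  ∫ u : ℝ, Complex.exp (Complex.I * t * u) * (θ.h σ u : ℂ)

/-- The characteristic function of the conditional density recentred at the null mean,
`∫ exp(itu) h(u + u0|σ) du`. -/
def hTilde (θ : EligibleModel) (σ t : ℝ) : ℂ :=
  ∫ u : ℝ, Complex.exp (Complex.I * t * u) * (θ.h σ (u + θ.u0) : ℂ)

/-- `σ0 ≥ a` and `∫ |x|^q f(x) dx ≤ A^q`. -/
def MomentCondition (θ : EligibleModel) (q a A : ℝ) : Prop :=
  a ≤ θ.σ0 ∧
    ∫⁻ x, ENNReal.ofReal (|x| ^ q * θ.density x) ≤ ENNReal.ofReal (A ^ q)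

/-- `limsup_{t → ∞} sup_{σ ≥ σ0} |t|^α |ĥ(t|σ)| ≤ A` and
`limsup_{t → ∞} sup_{σ ≥ σ0} |t|^(α+1) |h̃'(t|σ)| ≤ A`, where the derivative (in `t`) is
required to exist, for all large `t` and all `σ ≥ σ0`. -/
def SmoothnessCondition (θ : EligibleModel) (α A : ℝ) : Prop :=
  limsup (fun t : ℝ => ⨆ σ ∈ Ici θ.σ0, ENNReal.ofReal (|t| ^ α * ‖θ.hHat σ t‖)) atTop
      ≤ ENNReal.ofReal A ∧
  (∀ᶠ t : ℝ in atTop, ∀ σ ∈ Ici θ.σ0, DifferentiableAt ℝ (θ.hTilde σ) t) ∧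
  limsup (fun t : ℝ => ⨆ σ ∈ Ici θ.σ0,
      ENNReal.ofReal (|t| ^ (α + 1) * ‖deriv (θ.hTilde σ) t‖)) atTop
      ≤ ENNReal.ofReal A

end EligibleModel

/-- The parameter space `ℱ'₀` at a given lower bound `ηn` for the proportion:
eligible models satisfying the moment and smoothness conditions, with `ηn ≤ ε ≤ ε0`. -/
def paramSpace (α ε0 q a A ηn : ℝ) : Set EligibleModel :=
  {θ | θ.MomentCondition q a A ∧ θ.SmoothnessCondition α A ∧ ηn ≤ θ.ε ∧ θ.ε ≤ ε0}

/-- The minimax mean squared error `inf_T sup_{θ ∈ F} E_θ (T(X_1, …, X_n) - g(θ))²` for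
estimating `g(θ)` from `n` i.i.d. observations, over all estimators `T` (measurable functions
of the sample). -/
def minimaxRisk (n : ℕ) (F : Set EligibleModel) (g : EligibleModel → ℝ) : ℝ≥0∞ :=
  ⨅ (T : (Fin n → ℝ) → ℝ) (_ : Measurable T),
    ⨆ θ ∈ F, ∫⁻ x, ENNReal.ofReal ((T x - g θ) ^ 2) ∂(θ.sampleLaw n)

/-- Minimax risk `R_n^σ` for estimating the null variance parameter `σ0²`. -/
def minimaxRiskVar (n : ℕ) (F : Set EligibleModel) : ℝ≥0∞ :=
  minimaxRisk n F (fun θ => θ.σ0 ^ 2)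

/-- Minimax risk `R_n^u` for estimating the null mean parameter `u0`. -/
def minimaxRiskMean (n : ℕ) (F : Set EligibleModel) : ℝ≥0∞ :=
  minimaxRisk n F (fun θ => θ.u0)

end NullDensity

end

/-! The bound is a two-point argument: two models of the class, both with proportion ε = η_n, whose
densities are so close that n observations barely separate them, while their null means differ by d
and their null variances by r.

The model θ₂ has null law N(d, a²+r), nonnull scale √(a²+r) and nonnull means N(0, 1-r); its density
is (1-ε) N(d, a²+r) + ε N(0, a²+1). The model θ₁ has null law N(0, a²) and nonnull scale a. The
densities would coincide if the nonnull means of θ₁ had the signed law N(0, 1) + c (N(d, r) - δ₀)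
with c = (1-ε)/ε, since smoothing by N(0, a²) turns the bracket into N(d, a²+r) - N(0, a²). To get a
genuine density, N(d, r) - δ₀ is written as exp(-u²) times a factor with Fourier transform
`multiplier d r s - 1`, and this transform is cut off at |s| ≤ T. What remains is at most a constant
times (dT + rT²) T exp(-u²), so c times it is dominated by the standard normal density once dT² and
rT³ are small multiples of ε (`abs_perturbedNormal_sub_le`). The discarded frequencies are damped by
the Gaussian smoothing and change the density by only O(exp(-lT²))
(`exists_perturbation_error_bound`). With T² = (2/l) log n this is O(n⁻²), so the two samples share
half of their mass.

The smoothness conditions are limsups at infinity for each fixed model. The characteristic functions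
here are Gaussians or superpositions of Gaussians with bounded centres, so these limsups vanish.
Finally d = η T^{-(α+1)} or r = η T^{-(α+2)} makes dT² or rT³ equal to η T^{1-α} = o(η), and their
squares have the asserted orders. -/

namespace NullDensity

/-! ### The two-point lower bound -/

/-- The larger family need not be σ-finite, so no product formula is available for it. But
`OuterMeasure.pi` is the greatest outer measure bounded by the products on boxes, and `pi μ` obeys
that bound. -/
lemma pi_measure_mono {ι : Type*} [Fintype ι] {α : ι → Type*} [∀ i, MeasurableSpace (α i)]
    {μ ν : ∀ i, Measure (α i)} [∀ i, SigmaFinite (μ i)] (h : ∀ i, μ i ≤ ν i) :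
    Measure.pi μ ≤ Measure.pi ν := by
  have key : (Measure.pi μ).toOuterMeasure ≤ OuterMeasure.pi fun i => (ν i).toOuterMeasure := by
    rw [OuterMeasure.le_pi]
    intro s _
    change Measure.pi μ (Set.pi univ s) ≤ _
    rw [Measure.pi_pi]
    exact Finset.prod_le_prod' fun i _ => h i (s i)
  refine Measure.le_iff.2 fun s hs => ?_
  rw [show Measure.pi ν s = _ from by rw [Measure.pi, toMeasure_apply _ _ hs]]
  exact key s

/-- Le Cam's method with a common minorant `m` in place of a distance: the n-fold product of `m`
lies below both sample laws and keeps mass at least (1 - y)^n ≥ 1 - ny ≥ 1/2. Under it no estimator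
can be close to both targets. -/
lemma two_point_lower_bound {n : ℕ} {F : Set EligibleModel} {g : EligibleModel → ℝ}
    {θ₁ θ₂ : EligibleModel} (h₁ : θ₁ ∈ F) (h₂ : θ₂ ∈ F) {m : ℝ → ℝ} (hm : Integrable m)
    (hm₁ : ∀ x, m x ≤ θ₁.density x) (hm₂ : ∀ x, m x ≤ θ₂.density x) {y : ℝ} (hy : y ≤ 1)
    (hny : n * y ≤ 1 / 2) (hmass : 1 - y ≤ ∫ x, m x) :
    ENNReal.ofReal ((g θ₁ - g θ₂) ^ 2 / 8) ≤ minimaxRisk n F g := by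
  refine le_iInf₂ fun T hT => ?_
  set S := ⨆ θ ∈ F, ∫⁻ x, ENNReal.ofReal ((T x - g θ) ^ 2) ∂(θ.sampleLaw n) with hS
  set ν : Measure ℝ := volume.withDensity fun x => ENNReal.ofReal (m x) with hν
  have : IsFiniteMeasure ν := isFiniteMeasure_withDensity_ofReal hm.2
  have hle (θ : EligibleModel) (hθ : θ ∈ F) (hmθ : ∀ x, m x ≤ θ.density x) :
      ∫⁻ x, ENNReal.ofReal ((T x - g θ) ^ 2) ∂(Measure.pi fun _ : Fin n => ν) ≤ S := by
    have hl : ν ≤ θ.law :=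
      withDensity_mono (Eventually.of_forall fun x => ENNReal.ofReal_le_ofReal (hmθ x))
    refine (lintegral_mono' (pi_measure_mono fun _ => hl) le_rfl).trans ?_
    exact le_iSup₂_of_le (f := fun θ (_ : θ ∈ F) =>
      ∫⁻ x, ENNReal.ofReal ((T x - g θ) ^ 2) ∂(θ.sampleLaw n)) θ hθ le_rfl
  have hmassν : ENNReal.ofReal (1 / 2) ≤ (Measure.pi fun _ : Fin n => ν) univ := by
    rw [Measure.pi_univ, Finset.prod_const, Finset.card_univ, Fintype.card_fin]
    have h1 : ENNReal.ofReal (1 - y) ≤ ν univ := by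
      rw [hν, withDensity_apply _ MeasurableSet.univ, Measure.restrict_univ]
      refine (ENNReal.ofReal_le_ofReal hmass).trans ?_
      refine ENNReal.ofReal_le_of_le_toReal ?_
      have := integral_eq_lintegral_pos_part_sub_lintegral_neg_part hm
      rw [this]
      linarith [ENNReal.toReal_nonneg (a := ∫⁻ a, ENNReal.ofReal (-m a))]
    refine le_trans ?_ (pow_le_pow_left' h1 n)
    rw [← ENNReal.ofReal_pow (by linarith)]
    refine ENNReal.ofReal_le_ofReal ?_
    have := one_add_mul_le_pow (a := -y) (by linarith) n
    rw [← sub_eq_add_neg] at this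
    linarith
  have hsum : ENNReal.ofReal ((g θ₁ - g θ₂) ^ 2 / 4) ≤ S + S := by
    refine le_trans ?_ (add_le_add (hle θ₁ h₁ hm₁) (hle θ₂ h₂ hm₂))
    rw [← lintegral_add_left (by fun_prop)]
    calc ENNReal.ofReal ((g θ₁ - g θ₂) ^ 2 / 4)
        = ENNReal.ofReal ((g θ₁ - g θ₂) ^ 2 / 2) * ENNReal.ofReal (1 / 2) := by
          rw [← ENNReal.ofReal_mul (by positivity)]; congr 1; ring
      _ ≤ ENNReal.ofReal ((g θ₁ - g θ₂) ^ 2 / 2) * (Measure.pi fun _ : Fin n => ν) univ := by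
          gcongr
      _ = ∫⁻ _, ENNReal.ofReal ((g θ₁ - g θ₂) ^ 2 / 2) ∂(Measure.pi fun _ : Fin n => ν) := by
          rw [lintegral_const]
      _ ≤ _ := by
          refine lintegral_mono fun x => ?_
          rw [← ENNReal.ofReal_add (sq_nonneg _) (sq_nonneg _)]
          refine ENNReal.ofReal_le_ofReal ?_
          -- Parallelogram law: the two squared errors add up to at least half the squared distance
          -- of the targets.
          nlinarith [sq_nonneg ((T x - g θ₁) + (T x - g θ₂))]
  have h8 : ENNReal.ofReal ((g θ₁ - g θ₂) ^ 2 / 4)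
      = 2 * ENNReal.ofReal ((g θ₁ - g θ₂) ^ 2 / 8) := by
    rw [← ENNReal.ofReal_ofNat 2, ← ENNReal.ofReal_mul (by norm_num)]; congr 1; ring
  rw [h8, ← two_mul] at hsum
  exact (ENNReal.mul_le_mul_iff_right (by norm_num) (by norm_num)).1 hsum

/-! ### Normal densities -/

lemma normalDensity_eq_gaussianPDFReal {u σ : ℝ} (hσ : 0 < σ) (x : ℝ) :
    normalDensity u σ x = gaussianPDFReal u (σ ^ 2).toNNReal x := by
  rw [normalDensity, gaussianPDFReal, gaussianPDFReal, Real.coe_toNNReal _ (sq_nonneg σ)]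
  have h1 : √(2 * Real.pi * σ ^ 2) = √(2 * Real.pi) * σ := by
    rw [Real.sqrt_mul (by positivity), Real.sqrt_sq hσ.le]
  rw [h1, NNReal.coe_one, mul_one, mul_inv, one_div, ← mul_assoc, mul_comm σ⁻¹]
  congr 2
  field_simp
  ring

lemma normalDensity_eq {u σ : ℝ} (hσ : 0 < σ) (x : ℝ) :
    normalDensity u σ x = (√(2 * Real.pi * σ ^ 2))⁻¹ * Real.exp (-(x - u) ^ 2 / (2 * σ ^ 2)) := by
  rw [normalDensity_eq_gaussianPDFReal hσ, gaussianPDFReal, Real.coe_toNNReal _ (sq_nonneg σ)]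

lemma normalDensity_sqrt {u v : ℝ} (hv : 0 < v) (x : ℝ) :
    normalDensity u √v x = (√(2 * Real.pi * v))⁻¹ * Real.exp (-(x - u) ^ 2 / (2 * v)) := by
  rw [normalDensity_eq (Real.sqrt_pos.2 hv), Real.sq_sqrt hv.le]

lemma normalDensity_pos {u σ : ℝ} (hσ : 0 < σ) (x : ℝ) : 0 < normalDensity u σ x := by
  rw [normalDensity_eq hσ]; positivity

lemma integrable_normalDensity {u σ : ℝ} (hσ : 0 < σ) : Integrable (normalDensity u σ) := by
  rw [funext (normalDensity_eq_gaussianPDFReal hσ)]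
  exact integrable_gaussianPDFReal _ _

lemma integral_normalDensity {u σ : ℝ} (hσ : 0 < σ) : ∫ x, normalDensity u σ x = 1 := by
  rw [funext (normalDensity_eq_gaussianPDFReal hσ)]
  exact integral_gaussianPDFReal_eq_one _ (by simpa using hσ.ne')

lemma continuous_normalDensity (u σ : ℝ) : Continuous (normalDensity u σ) := by
  unfold normalDensity gaussianPDFReal; fun_prop

lemma continuous_normalDensity_left (σ x : ℝ) : Continuous fun u => normalDensity u σ x := by
  unfold normalDensity gaussianPDFReal; fun_prop

lemma normalDensity_le {u σ : ℝ} (hσ : 0 < σ) (x : ℝ) :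
    normalDensity u σ x ≤ (√(2 * Real.pi * σ ^ 2))⁻¹ := by
  rw [normalDensity_eq hσ]
  refine mul_le_of_le_one_right (by positivity) (Real.exp_le_one_iff.2 ?_)
  have : 0 ≤ (x - u) ^ 2 / (2 * σ ^ 2) := by positivity
  rw [neg_div]; linarith

lemma lintegral_absMoment {σ : ℝ} (hσ : 0 < σ) {q : ℝ} (hq : 0 < q) :
    ∫⁻ x, ENNReal.ofReal (|x| ^ q * normalDensity 0 σ x)
      = ENNReal.ofReal (σ ^ q * normalAbsMoment q) := by
  have hint : Integrable (fun x : ℝ => |x| ^ q) (gaussianReal 0 1) := by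
    have := (memLp_id_gaussianReal (μ := 0) (v := 1) q.toNNReal).integrable_norm_rpow
      (by simpa using hq) (by simp)
    simpa [hq.le] using this
  have hσ2 : (σ ^ 2).toNNReal ≠ 0 := by simpa using hσ.ne'
  have hmap : gaussianReal 0 (σ ^ 2).toNNReal = (gaussianReal 0 1).map (σ * ·) := by
    rw [gaussianReal_map_const_mul, mul_zero, mul_one]
    congr 1
    exact Real.toNNReal_of_nonneg (sq_nonneg σ)
  calc ∫⁻ x, ENNReal.ofReal (|x| ^ q * normalDensity 0 σ x)
      = ∫⁻ x, ENNReal.ofReal (|x| ^ q) ∂(gaussianReal 0 (σ ^ 2).toNNReal) := by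
        rw [gaussianReal_of_var_ne_zero _ hσ2, lintegral_withDensity_eq_lintegral_mul _
          (measurable_gaussianPDF _ _) (by fun_prop)]
        refine lintegral_congr fun x => ?_
        rw [normalDensity_eq_gaussianPDFReal hσ, ENNReal.ofReal_mul (by positivity), mul_comm]
        rfl
    _ = ∫⁻ x, ENNReal.ofReal (σ ^ q) * ENNReal.ofReal (|x| ^ q) ∂(gaussianReal 0 1) := by
        rw [hmap, lintegral_map (by fun_prop) (by fun_prop)]
        refine lintegral_congr fun x => ?_
        rw [abs_mul, abs_of_pos hσ, Real.mul_rpow hσ.le (abs_nonneg x),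
          ENNReal.ofReal_mul (by positivity)]
    _ = ENNReal.ofReal (σ ^ q * normalAbsMoment q) := by
        rw [lintegral_const_mul _ (by fun_prop), normalAbsMoment,
          ENNReal.ofReal_mul (by positivity), ofReal_integral_eq_lintegral_ofReal hint
            (Eventually.of_forall fun x => by positivity)]

lemma normalAbsMoment_nonneg (q : ℝ) : 0 ≤ normalAbsMoment q :=
  integral_nonneg fun x => by positivity

/-- A completed square: the convolution of `N(0, v)` with a modulated `N(0, τ)` profile. -/
lemma integral_gaussian_conv {v τ : ℝ} (hv : 0 < v) (hτ : 0 < τ) (x s : ℝ) :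
    ∫ u : ℝ, Complex.exp ((-(x - u) ^ 2 / (2 * v) - u ^ 2 / (2 * τ) : ℝ) + Complex.I * s * u)
      = √(2 * Real.pi * v * τ / (v + τ)) * Complex.exp ((-x ^ 2 / (2 * (v + τ))
          - s ^ 2 * (v * τ / (2 * (v + τ))) : ℝ) + Complex.I * (s * x * τ / (v + τ) : ℝ)) := by
  have hb : (-((v + τ) / (2 * v * τ) : ℝ) : ℂ).re < 0 := by
    rw [Complex.neg_re, Complex.ofReal_re, neg_lt_zero]; positivity
  have h := integral_cexp_quadratic hb (x / v + Complex.I * s) (-x ^ 2 / (2 * v))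
  have hv' : (v : ℂ) ≠ 0 := by exact_mod_cast hv.ne'
  have hτ' : (τ : ℂ) ≠ 0 := by exact_mod_cast hτ.ne'
  have hvτ : (v + τ : ℂ) ≠ 0 := by exact_mod_cast (add_pos hv hτ).ne'
  convert h using 1
  · congr 1; ext u; congr 1
    push_cast
    field_simp
    ring
  · congr 1
    · rw [neg_neg, ← Complex.ofReal_div,
        show (1 / 2 : ℂ) = ((1 / 2 : ℝ) : ℂ) by push_cast; rfl,
        ← Complex.ofReal_cpow (by positivity), ← Real.sqrt_eq_rpow]
      congr 2
      field_simp
    · congr 1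
      push_cast
      field_simp
      ring_nf
      simp only [Complex.I_sq]
      ring

/-! ### Modulated Gaussian superpositions -/

/-- The multiplier `s ↦ ∫ exp(u² - isu) dN(d, r)(u)` of the normal law `N(d, r)`. -/
noncomputable def multiplier (d r s : ℝ) : ℂ :=
  ((√(1 - 2 * r))⁻¹ : ℝ) *
    Complex.exp (((d ^ 2 - r * s ^ 2 / 2) / (1 - 2 * r) : ℝ) - Complex.I * (s * d / (1 - 2 * r) : ℝ))

/-- The convolution of `N(0, v)` with `u ↦ exp(-u² + isu)`, evaluated at `x`. -/
noncomputable def modulatedKernel (v s x : ℝ) : ℂ :=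
  ((√(2 * v + 1))⁻¹ : ℝ) * Complex.exp ((-x ^ 2 / (2 * v + 1) - s ^ 2 * (v / (2 * (2 * v + 1))) : ℝ)
    + Complex.I * (s * x / (2 * v + 1) : ℝ))

/-- The inverse Fourier transform of `multiplier d r - 1` truncated to frequencies in `[-T, T]`,
times the envelope `exp(-u²)`. -/
noncomputable def perturbation (d r T u : ℝ) : ℝ :=
  Real.exp (-u ^ 2) / (2 * Real.pi) *
    (∫ s in -T..T, (multiplier d r s - 1) * Complex.exp (Complex.I * s * u)).re

lemma continuous_multiplier (d r : ℝ) : Continuous (multiplier d r) := by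
  unfold multiplier; fun_prop

lemma continuous_multiplier_sub_one (d r : ℝ) : Continuous fun s => multiplier d r s - 1 :=
  (continuous_multiplier d r).sub continuous_const

lemma multiplier_zero (s : ℝ) : multiplier 0 0 s = 1 := by simp [multiplier]

lemma continuous_modulatedKernel (v x : ℝ) : Continuous fun s => modulatedKernel v s x := by
  unfold modulatedKernel; fun_prop

lemma norm_cexp_add_I (x y : ℝ) : ‖Complex.exp (x + Complex.I * y)‖ = Real.exp x := by
  rw [Complex.norm_exp]; simp

lemma norm_cexp_sub_I (x y : ℝ) : ‖Complex.exp (x - Complex.I * y)‖ = Real.exp x := by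
  rw [Complex.norm_exp]; simp

lemma norm_cexp_I_mul_mul (s u : ℝ) : ‖Complex.exp (Complex.I * s * u)‖ = 1 := by
  rw [Complex.norm_exp]; simp

lemma norm_multiplier_le {d r : ℝ} (hd0 : 0 ≤ d) (hd : d ≤ 1) (hr0 : 0 ≤ r) (hr : r ≤ 1 / 4)
    (s : ℝ) : ‖multiplier d r s‖ ≤ 2 * Real.exp 2 := by
  have h1 : (0 : ℝ) < 1 - 2 * r := by linarith
  rw [multiplier, norm_mul, norm_cexp_sub_I, Complex.norm_real, Real.norm_of_nonneg (by positivity)]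
  gcongr
  · rw [inv_le_comm₀ (by positivity) (by norm_num)]
    exact Real.le_sqrt_of_sq_le (by linarith)
  · rw [div_le_iff₀ h1]
    nlinarith [mul_nonneg hr0 (sq_nonneg s)]

lemma norm_multiplier_sub_one_le_const {d r : ℝ} (hd0 : 0 ≤ d) (hd : d ≤ 1) (hr0 : 0 ≤ r)
    (hr : r ≤ 1 / 4) (s : ℝ) : ‖multiplier d r s - 1‖ ≤ 2 * Real.exp 2 + 1 :=
  (norm_sub_le _ _).trans (by simpa using norm_multiplier_le hd0 hd hr0 hr s)

/-- With its normalising factor absorbed, the multiplier is a single exponential, and ‖exp z - 1‖ ≤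
2‖z‖ for ‖z‖ ≤ 1. The shift d enters through a phase of order dT, the variance r through rT²; this
extra factor T separates the exponents α + 1 and α + 2. -/
lemma norm_multiplier_sub_one_le {d r s T : ℝ} (hd0 : 0 ≤ d) (hd : d ≤ 1) (hr0 : 0 ≤ r)
    (hr : r ≤ 1 / 4) (hT : 1 ≤ T) (hs : |s| ≤ T) (hsmall : 4 * d * T + 3 * r * T ^ 2 ≤ 1) :
    ‖multiplier d r s - 1‖ ≤ 2 * (4 * d * T + 3 * r * T ^ 2) := by
  have h1 : (0 : ℝ) < 1 - 2 * r := by linarith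
  set a : ℝ := -(Real.log (1 - 2 * r) / 2) with ha
  set b : ℝ := (d ^ 2 - r * s ^ 2 / 2) / (1 - 2 * r) with hb
  set c : ℝ := s * d / (1 - 2 * r) with hc
  have hm : multiplier d r s = Complex.exp (a + (b - Complex.I * c)) := by
    rw [multiplier, Complex.exp_add, ← Complex.ofReal_exp, ha, Real.exp_neg, Real.exp_half,
      Real.exp_log h1]
  have hinv : (1 - 2 * r)⁻¹ ≤ 2 := by
    rw [inv_le_comm₀ h1 (by norm_num)]; linarith
  have hs2 : s ^ 2 ≤ T ^ 2 := by rw [← sq_abs]; gcongr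
  have hna : |a| ≤ 2 * r := by
    have h2 := Real.one_sub_inv_le_log_of_pos h1
    have h3 : Real.log (1 - 2 * r) ≤ 0 := Real.log_nonpos h1.le (by linarith)
    have h4 : (1 - 2 * r)⁻¹ ≤ 1 + 4 * r := by
      rw [inv_le_iff_one_le_mul₀ h1]; nlinarith
    rw [ha, abs_of_nonneg (by linarith)]
    linarith
  have hnb : |b| ≤ 2 * d ^ 2 + r * s ^ 2 := by
    rw [hb, div_eq_mul_inv, abs_mul, abs_of_pos (inv_pos.2 h1)]
    have : |d ^ 2 - r * s ^ 2 / 2| ≤ d ^ 2 + r * s ^ 2 / 2 :=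
      abs_le.2 ⟨by nlinarith [sq_nonneg d], by nlinarith [mul_nonneg hr0 (sq_nonneg s)]⟩
    calc _ ≤ (d ^ 2 + r * s ^ 2 / 2) * 2 := by gcongr
      _ = _ := by ring
  have hnc : |c| ≤ 2 * (T * d) := by
    rw [hc, div_eq_mul_inv, abs_mul, abs_of_pos (inv_pos.2 h1), abs_mul, abs_of_nonneg hd0]
    calc |s| * d * (1 - 2 * r)⁻¹ ≤ T * d * 2 := by gcongr
      _ = _ := by ring
  have hz : ‖(a + (b - Complex.I * c) : ℂ)‖ ≤ 4 * d * T + 3 * r * T ^ 2 := by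
    calc ‖(a + (b - Complex.I * c) : ℂ)‖ ≤ ‖(a : ℂ)‖ + (‖(b : ℂ)‖ + ‖Complex.I * c‖) :=
          (norm_add_le _ _).trans (by gcongr; exact norm_sub_le _ _)
      _ = |a| + (|b| + |c|) := by simp
      _ ≤ 2 * r + (2 * d ^ 2 + r * s ^ 2 + 2 * (T * d)) := by gcongr
      _ ≤ _ := by
        have h5 : d ^ 2 ≤ T * d := by nlinarith
        have h6 : r * s ^ 2 ≤ r * T ^ 2 := by gcongr
        have h7 : r * 1 ≤ r * T ^ 2 := by gcongr; nlinarith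
        nlinarith
  rw [hm]
  exact (Complex.norm_exp_sub_one_le (hz.trans hsmall)).trans (by gcongr)

lemma conj_multiplier (d r s : ℝ) :
    (starRingEnd ℂ) (multiplier d r s) = multiplier d r (-s) := by
  simp only [multiplier, map_mul, Complex.conj_ofReal, ← Complex.exp_conj, map_sub, Complex.conj_I]
  congr 2
  push_cast
  ring

/-- The multiplier is Hermitian, so the integral over a symmetric interval is its own conjugate and
taking `re` in `perturbation` discards nothing. -/
lemma ofReal_perturbation (d r T u : ℝ) :
    (perturbation d r T u : ℂ) = (Real.exp (-u ^ 2) / (2 * Real.pi) : ℝ) *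
      ∫ s in -T..T, (multiplier d r s - 1) * Complex.exp (Complex.I * s * u) := by
  set J := ∫ s in -T..T, (multiplier d r s - 1) * Complex.exp (Complex.I * s * u) with hJ
  have hconj : (starRingEnd ℂ) J = J := by
    rw [hJ, ← intervalIntegral.intervalIntegral_conj]
    conv_rhs => rw [← neg_neg T, neg_neg (-T), ← intervalIntegral.integral_comp_neg]
    refine intervalIntegral.integral_congr fun s _ => ?_
    simp only [map_mul, map_sub, map_one, conj_multiplier, ← Complex.exp_conj, Complex.conj_I,
      Complex.conj_ofReal]
    congr 2
    push_cast
    ring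
  rw [perturbation, ← hJ, Complex.ofReal_mul, Complex.conj_eq_iff_re.1 hconj]

lemma abs_perturbation_le {d r T b : ℝ} (hT : 0 ≤ T)
    (hb : ∀ s, |s| ≤ T → ‖multiplier d r s - 1‖ ≤ b) (u : ℝ) :
    |perturbation d r T u| ≤ b * T * Real.exp (-u ^ 2) := by
  have hb0 : 0 ≤ b := (norm_nonneg _).trans (hb 0 (by simpa using hT))
  have h : ‖∫ s in -T..T, (multiplier d r s - 1) * Complex.exp (Complex.I * s * u)‖
      ≤ b * |T - -T| := by
    refine intervalIntegral.norm_integral_le_of_norm_le_const fun s hs => ?_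
    rw [norm_mul, norm_cexp_I_mul_mul, mul_one]
    rw [uIoc_of_le (by linarith)] at hs
    exact hb s (abs_le.2 ⟨hs.1.le, hs.2⟩)
  rw [abs_of_nonneg (by linarith)] at h
  rw [perturbation, abs_mul, abs_of_pos (by positivity)]
  calc _ ≤ Real.exp (-u ^ 2) / (2 * Real.pi) * (b * (T - -T)) := by
        gcongr; exact (Complex.abs_re_le_norm _).trans h
    _ = b * T * Real.exp (-u ^ 2) / Real.pi := by field_simp; ring
    _ ≤ _ := div_le_self (by positivity) (by linarith [Real.pi_gt_three])

lemma continuous_perturbation (d r T : ℝ) : Continuous (perturbation d r T) := by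
  unfold perturbation
  refine Continuous.mul (by fun_prop) (Complex.continuous_re.comp ?_)
  refine intervalIntegral.continuous_parametric_intervalIntegral_of_continuous' ?_ _ _
  have := continuous_multiplier d r
  fun_prop

/-- Fubini for an integrable function against a truncated inverse Fourier integral. -/
lemma integral_mul_intervalIntegral_swap {k μ : ℝ → ℂ} (hk : Integrable k) (hμ : Continuous μ)
    {T : ℝ} (hT : 0 ≤ T) :
    ∫ u, k u * ∫ s in -T..T, μ s * Complex.exp (Complex.I * s * u)
      = ∫ s in -T..T, μ s * ∫ u : ℝ, k u * Complex.exp (Complex.I * s * u) := by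
  simp_rw [intervalIntegral.integral_of_le (show -T ≤ T by linarith), ← integral_const_mul]
  rw [integral_integral_swap]
  · congr 1; ext s; congr 1; ext u; ring
  · have hμi : Integrable μ (volume.restrict (Ioc (-T) T)) :=
      (hμ.integrableOn_Icc (a := -T) (b := T)).mono_set Ioc_subset_Icc_self
    have h := (hk.mul_prod hμi).mul_bdd (c := 1)
      (g := fun p : ℝ × ℝ => Complex.exp (Complex.I * p.2 * p.1))
      (Continuous.aestronglyMeasurable (by fun_prop))
      (Eventually.of_forall fun p => (norm_cexp_I_mul_mul _ _).le)
    refine h.congr (Eventually.of_forall fun p => ?_)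
    simp [Function.uncurry, mul_assoc]

lemma integrable_gaussian_mul {k : ℝ → ℝ} (hk : Continuous k) {C : ℝ} (hC : ∀ u, |k u| ≤ C) :
    Integrable fun u : ℝ => k u * Real.exp (-u ^ 2) := by
  have := integrable_exp_neg_mul_sq (b := 1) one_pos
  simp only [neg_mul, one_mul] at this
  exact this.bdd_mul hk.aestronglyMeasurable (Eventually.of_forall hC)

lemma integrable_perturbation (d r T : ℝ) (hT : 0 ≤ T) : Integrable (perturbation d r T) := by
  obtain ⟨b, hb⟩ := (isCompact_Icc (a := -T) (b := T)).exists_bound_of_continuousOn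
    (f := fun s => multiplier d r s - 1)
    (continuous_multiplier_sub_one d r).continuousOn
  have := integrable_exp_neg_mul_sq (b := 1) one_pos
  simp only [neg_mul, one_mul] at this
  exact (this.const_mul (b * T)).mono' (continuous_perturbation d r T).aestronglyMeasurable
    (Eventually.of_forall fun u => abs_perturbation_le hT (fun s hs => hb s (abs_le.1 hs)) u)

lemma integral_normalDensity_mul_perturbation (d r : ℝ) {T v : ℝ} (hT : 0 ≤ T) (hv : 0 < v)
    (x : ℝ) :
    ((∫ u, normalDensity u √v x * perturbation d r T u : ℝ) : ℂ)
      = (2 * Real.pi : ℂ)⁻¹ * ∫ s in -T..T, (multiplier d r s - 1) * modulatedKernel v s x := by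
  have hσ := Real.sqrt_pos.2 hv
  rw [← integral_complex_ofReal]
  have hk : Integrable fun u : ℝ => ((normalDensity u √v x * Real.exp (-u ^ 2) : ℝ) : ℂ) :=
    (integrable_gaussian_mul (continuous_normalDensity_left _ x) (fun u => by
      rw [abs_of_pos (normalDensity_pos hσ x)]; exact normalDensity_le hσ x)).ofReal
  have h := integral_mul_intervalIntegral_swap hk
    (continuous_multiplier_sub_one d r) hT
  calc _ = ∫ u : ℝ, (2 * Real.pi : ℂ)⁻¹ * (((normalDensity u √v x * Real.exp (-u ^ 2) : ℝ) : ℂ) *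
        ∫ s in -T..T, (multiplier d r s - 1) * Complex.exp (Complex.I * s * u)) := by
        congr 1; ext u
        rw [Complex.ofReal_mul, ofReal_perturbation]
        push_cast
        ring
    _ = _ := by
        rw [integral_const_mul, h]
        congr 1
        refine intervalIntegral.integral_congr fun s _ => ?_
        congr 1
        -- The envelope exp(-u²) is a Gaussian profile of variance 1/2.
        have hg := integral_gaussian_conv hv (τ := 1 / 2) (by norm_num) x s
        calc ∫ u : ℝ, ((normalDensity u √v x * Real.exp (-u ^ 2) : ℝ) : ℂ) *
              Complex.exp (Complex.I * s * u)
            = ∫ u : ℝ, ((√(2 * Real.pi * v))⁻¹ : ℝ) * Complex.exp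
              ((-(x - u) ^ 2 / (2 * v) - u ^ 2 / (2 * (1 / 2)) : ℝ) + Complex.I * s * u) := by
              congr 1; ext u
              rw [normalDensity_sqrt hv, Complex.exp_add, ← Complex.ofReal_exp,
                show -(x - u) ^ 2 / (2 * v) - u ^ 2 / (2 * (1 / 2))
                  = -(x - u) ^ 2 / (2 * v) + -u ^ 2 by ring, Real.exp_add]
              push_cast
              ring
          _ = modulatedKernel v s x := by
              rw [integral_const_mul, hg, modulatedKernel, ← mul_assoc, ← Complex.ofReal_mul]
              have h2 : √(2 * Real.pi * v * (1 / 2) / (v + 1 / 2))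
                  = √(2 * Real.pi * v) * (√(2 * v + 1))⁻¹ := by
                rw [← Real.sqrt_inv, ← Real.sqrt_mul (by positivity)]
                congr 1
                field_simp
              have h3 : √(2 * Real.pi * v) ≠ 0 := by positivity
              rw [h2, ← mul_assoc, inv_mul_cancel₀ h3, one_mul]
              rw [show v + 1 / 2 = (2 * v + 1) / 2 by ring]
              congr 5 <;> field_simp

lemma integral_cexp_quadratic_ofReal {b : ℝ} (hb : 0 < b) (c d : ℂ) :
    ∫ x : ℝ, Complex.exp (-b * x ^ 2 + c * x + d)
      = √(Real.pi / b) * Complex.exp (d + c ^ 2 / (4 * b)) := by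
  have h := integral_cexp_quadratic (b := -b) (by simpa using hb) c d
  rw [h, neg_neg, ← Complex.ofReal_div, show (1 / 2 : ℂ) = ((1 / 2 : ℝ) : ℂ) by push_cast; rfl,
    ← Complex.ofReal_cpow (by positivity), ← Real.sqrt_eq_rpow]
  congr 2
  rw [mul_neg, div_neg, sub_neg_eq_add]

/-- Fourier inversion without the cutoff: the envelope cancels the weight exp(u²) inside the
multiplier, leaving N(d, r) convolved with N(0, v). The case d = r = 0 is the point mass at 0. -/
lemma integral_multiplier_mul_modulatedKernel {v r : ℝ} (hv : 0 < v) (hr0 : 0 ≤ r)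
    (hr : r < 1 / 2) (d x : ℝ) :
    ∫ s, multiplier d r s * modulatedKernel v s x
      = (2 * Real.pi * normalDensity d √(v + r) x : ℝ) := by
  have hp : 0 < 1 - 2 * r := by linarith
  have hk : 0 < 2 * v + 1 := by linarith
  have hvr : 0 < v + r := by linarith
  have hb : 0 < (v + r) / (2 * (1 - 2 * r) * (2 * v + 1)) := by positivity
  have h := integral_cexp_quadratic_ofReal hb (Complex.I * (x / (2 * v + 1) - d / (1 - 2 * r) : ℝ))
    (d ^ 2 / (1 - 2 * r) - x ^ 2 / (2 * v + 1) : ℝ)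
  have hp' : (1 - 2 * r : ℂ) ≠ 0 := by exact_mod_cast hp.ne'
  have hk' : (2 * v + 1 : ℂ) ≠ 0 := by exact_mod_cast hk.ne'
  have hvr' : (v + r : ℂ) ≠ 0 := by exact_mod_cast hvr.ne'
  calc ∫ s, multiplier d r s * modulatedKernel v s x
      = ∫ s : ℝ, ((√(1 - 2 * r))⁻¹ * (√(2 * v + 1))⁻¹ : ℝ) *
        Complex.exp (-((v + r) / (2 * (1 - 2 * r) * (2 * v + 1)) : ℝ) * s ^ 2
          + (Complex.I * (x / (2 * v + 1) - d / (1 - 2 * r) : ℝ)) * s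
          + (d ^ 2 / (1 - 2 * r) - x ^ 2 / (2 * v + 1) : ℝ)) := by
        congr 1; ext s
        rw [multiplier, modulatedKernel, mul_mul_mul_comm, ← Complex.exp_add, ← Complex.ofReal_mul]
        congr 2
        push_cast
        -- Trading r for p = 1 - 2r makes this denominator atomic.
        obtain ⟨p, hpr⟩ : ∃ p : ℂ, 1 - 2 * (r : ℂ) = p := ⟨_, rfl⟩
        rw [hpr] at hp' ⊢
        rw [show (r : ℂ) = (1 - p) / 2 by rw [← hpr]; ring]
        field_simp
        ring
    _ = _ := by
        rw [integral_const_mul, h, normalDensity_sqrt hvr, ← mul_assoc, ← Complex.ofReal_mul,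
          ← mul_assoc, Complex.ofReal_mul (2 * Real.pi * _), Complex.ofReal_exp]
        congr 1
        · congr 1
          have e : Real.pi / ((v + r) / (2 * (1 - 2 * r) * (2 * v + 1)))
              = (1 - 2 * r) * ((2 * v + 1) * ((2 * Real.pi) ^ 2 * (2 * Real.pi * (v + r))⁻¹)) := by
            field_simp
          rw [e, Real.sqrt_mul hp.le, Real.sqrt_mul hk.le, Real.sqrt_mul (by positivity),
            Real.sqrt_sq (by positivity), Real.sqrt_inv]
          field_simp
        · congr 1
          rw [mul_pow, Complex.I_sq]
          have e : (d ^ 2 / (1 - 2 * r) - x ^ 2 / (2 * v + 1)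
              + -1 * (x / (2 * v + 1) - d / (1 - 2 * r)) ^ 2
                / (4 * ((v + r) / (2 * (1 - 2 * r) * (2 * v + 1)))) : ℝ)
              = -(x - d) ^ 2 / (2 * (v + r)) := by
            have := hp.ne'; have := hk.ne'; have := hvr.ne'
            rw [eq_div_iff (by positivity)]
            field_simp
            ring
          rw [← e]
          push_cast
          ring

/-- The value does not depend on d and r because N(d, r) has mass one: √π exp(-s²/4) is the
transform of the envelope. Hence the untruncated perturbation has total mass zero. -/
lemma integral_multiplier_mul_exp {r : ℝ} (hr : r < 1 / 2) (d : ℝ) :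
    ∫ s : ℝ, multiplier d r s * Real.exp (-s ^ 2 / 4) = (2 * √Real.pi : ℝ) := by
  have hp : 0 < 1 - 2 * r := by linarith
  have hp' : (1 - 2 * r : ℂ) ≠ 0 := by exact_mod_cast hp.ne'
  have h := integral_cexp_quadratic_ofReal (b := 1 / (4 * (1 - 2 * r))) (by positivity)
    (-Complex.I * (d / (1 - 2 * r) : ℝ)) (d ^ 2 / (1 - 2 * r) : ℝ)
  calc ∫ s : ℝ, multiplier d r s * Real.exp (-s ^ 2 / 4)
      = ∫ s : ℝ, ((√(1 - 2 * r))⁻¹ : ℝ) *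
        Complex.exp (-(1 / (4 * (1 - 2 * r)) : ℝ) * s ^ 2
          + (-Complex.I * (d / (1 - 2 * r) : ℝ)) * s + (d ^ 2 / (1 - 2 * r) : ℝ)) := by
        congr 1; ext s
        rw [multiplier, mul_assoc, Complex.ofReal_exp, ← Complex.exp_add]
        congr 2
        push_cast
        obtain ⟨p, hpr⟩ : ∃ p : ℂ, 1 - 2 * (r : ℂ) = p := ⟨_, rfl⟩
        rw [hpr] at hp' ⊢
        rw [show (r : ℂ) = (1 - p) / 2 by rw [← hpr]; ring]
        field_simp
        ring
    _ = _ := by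
        have e : ((d ^ 2 / (1 - 2 * r) : ℝ) + (-Complex.I * (d / (1 - 2 * r) : ℝ)) ^ 2
            / (4 * ((1 / (4 * (1 - 2 * r)) : ℝ) : ℂ)) : ℂ) = 0 := by
          rw [mul_pow, neg_sq, Complex.I_sq]
          push_cast
          field_simp
          ring
        rw [integral_const_mul, h, e, Complex.exp_zero, mul_one, ← Complex.ofReal_mul]
        congr 1
        rw [show Real.pi / (1 / (4 * (1 - 2 * r))) = (1 - 2 * r) * (2 ^ 2 * Real.pi) by
          field_simp; ring, Real.sqrt_mul hp.le, Real.sqrt_mul (by positivity),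
          Real.sqrt_sq (by positivity)]
        field_simp

/-- The Fourier transform of the perturbation is a truncated superposition of Gaussians. -/
lemma integral_cexp_mul_perturbation (d r : ℝ) {T : ℝ} (hT : 0 ≤ T) (t : ℝ) :
    ∫ u : ℝ, Complex.exp (Complex.I * t * u) * perturbation d r T u
      = (2 * Real.pi : ℂ)⁻¹ * ∫ s in -T..T, (multiplier d r s - 1) *
        ((√Real.pi * Real.exp (-(s + t) ^ 2 / 4) : ℝ) : ℂ) := by
  have hg := integrable_exp_neg_mul_sq (b := 1) one_pos
  simp only [neg_mul, one_mul] at hg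
  have hk : Integrable fun u : ℝ => Complex.exp (Complex.I * t * u) * (Real.exp (-u ^ 2) : ℂ) :=
    hg.ofReal.bdd_mul (c := 1) (Continuous.aestronglyMeasurable (by fun_prop))
      (Eventually.of_forall fun u => (norm_cexp_I_mul_mul t u).le)
  have h := integral_mul_intervalIntegral_swap hk (continuous_multiplier_sub_one d r) hT
  calc _ = ∫ u : ℝ, (2 * Real.pi : ℂ)⁻¹ * ((Complex.exp (Complex.I * t * u) *
        (Real.exp (-u ^ 2) : ℂ)) *
        ∫ s in -T..T, (multiplier d r s - 1) * Complex.exp (Complex.I * s * u)) := by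
        congr 1; ext u
        rw [ofReal_perturbation]
        push_cast
        ring
    _ = _ := by
        rw [integral_const_mul, h]
        congr 1
        refine intervalIntegral.integral_congr fun s _ => ?_
        congr 1
        have h2 := integral_cexp_quadratic_ofReal one_pos (Complex.I * (s + t)) 0
        calc ∫ u : ℝ, Complex.exp (Complex.I * t * u) * (Real.exp (-u ^ 2) : ℂ) *
              Complex.exp (Complex.I * s * u)
            = ∫ u : ℝ, Complex.exp (-(1 : ℝ) * u ^ 2 + (Complex.I * (s + t)) * u + 0) := by
              congr 1; ext u
              rw [Complex.ofReal_exp, ← Complex.exp_add, ← Complex.exp_add]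
              congr 1
              push_cast
              ring
          _ = _ := by
              rw [h2, div_one, Complex.ofReal_mul, Complex.ofReal_exp, mul_pow, Complex.I_sq]
              congr 2
              push_cast
              ring

lemma ofReal_integral_perturbation (d r : ℝ) {T : ℝ} (hT : 0 ≤ T) :
    ((∫ u, perturbation d r T u : ℝ) : ℂ)
      = (2 * Real.pi : ℂ)⁻¹ * ∫ s in -T..T, (multiplier d r s - 1) *
        ((√Real.pi * Real.exp (-s ^ 2 / 4) : ℝ) : ℂ) := by
  have h := integral_cexp_mul_perturbation d r hT 0
  simp only [Complex.ofReal_zero, mul_zero, zero_mul, Complex.exp_zero, one_mul, add_zero] at h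
  rw [← h, integral_complex_ofReal]

/-- Half of the decay rate 2l yields the factor exp(-lT²) off the interval; the other half keeps the
tail integrable. -/
lemma norm_integral_sub_intervalIntegral_le {f : ℝ → ℂ} (hf : Continuous f) {D l : ℝ}
    (hl : 0 < l) (hD : ∀ s, ‖f s‖ ≤ D * Real.exp (-(2 * l) * s ^ 2)) {T : ℝ} (hT : 0 ≤ T) :
    ‖(∫ s, f s) - ∫ s in -T..T, f s‖ ≤ D * √(Real.pi / l) * Real.exp (-l * T ^ 2) := by
  have hD0 : 0 ≤ D := by simpa using (norm_nonneg _).trans (hD 0)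
  have hfi : Integrable f := ((integrable_exp_neg_mul_sq (b := 2 * l) (by positivity)).const_mul
    D).mono' hf.aestronglyMeasurable (Eventually.of_forall hD)
  have hg := integrable_exp_neg_mul_sq hl
  rw [intervalIntegral.integral_of_le (by linarith), ← integral_add_compl measurableSet_Ioc hfi,
    add_sub_cancel_left]
  have hbound : ∀ s ∈ (Ioc (-T) T)ᶜ,
      ‖f s‖ ≤ D * Real.exp (-l * T ^ 2) * Real.exp (-l * s ^ 2) := by
    intro s hs
    refine (hD s).trans ?_
    rw [mul_assoc, ← Real.exp_add]
    have hs' : T ^ 2 ≤ s ^ 2 := by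
      rw [mem_compl_iff, mem_Ioc, not_and_or, not_lt, not_le] at hs
      rcases hs with hs | hs <;> nlinarith
    gcongr
    nlinarith
  calc _ ≤ ∫ s in (Ioc (-T) T)ᶜ, D * Real.exp (-l * T ^ 2) * Real.exp (-l * s ^ 2) :=
        norm_integral_le_of_norm_le (hg.const_mul _).integrableOn
          ((ae_restrict_iff' measurableSet_Ioc.compl).2 (Eventually.of_forall hbound))
    _ ≤ ∫ s, D * Real.exp (-l * T ^ 2) * Real.exp (-l * s ^ 2) :=
        setIntegral_le_integral (hg.const_mul _) (Eventually.of_forall fun s => by positivity)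
    _ = _ := by rw [integral_const_mul, integral_gaussian]; ring

lemma norm_modulatedKernel_le {v : ℝ} (hv : 0 < v) (s x : ℝ) :
    ‖modulatedKernel v s x‖
      ≤ Real.exp (-x ^ 2 / (2 * v + 1)) * Real.exp (-(2 * (v / (4 * (2 * v + 1)))) * s ^ 2) := by
  rw [modulatedKernel, norm_mul, norm_cexp_add_I, Complex.norm_real,
    Real.norm_of_nonneg (by positivity), ← Real.exp_add]
  refine (mul_le_of_le_one_left (by positivity) ?_).trans (le_of_eq ?_)
  · refine inv_le_one_of_one_le₀ (Real.one_le_sqrt.2 (by linarith))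
  · congr 1
    field_simp
    ring

/-- Smoothing by `N(0, v)` makes the truncation of the frequencies almost invisible. -/
lemma exists_perturbation_error_bound {v : ℝ} (hv : 0 < v) :
    ∃ K > 0, ∃ l > 0, ∀ d r T : ℝ, 0 ≤ d → d ≤ 1 → 0 ≤ r → r ≤ 1 / 4 → 0 ≤ T →
      (∀ x, |(∫ u, normalDensity u √v x * perturbation d r T u)
          - (normalDensity d √(v + r) x - normalDensity 0 √v x)|
        ≤ K * Real.exp (-l * T ^ 2) * normalDensity 0 √(v + 1) x) ∧
      |∫ u, perturbation d r T u| ≤ K * Real.exp (-l * T ^ 2) := by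
  set l := v / (4 * (2 * v + 1)) with hl
  have hlpos : 0 < l := by positivity
  set M : ℝ := 2 * Real.exp 2 + 1 with hM
  set N : ℝ := √(2 * Real.pi * (v + 1)) with hN
  have hNpos : 0 < N := by positivity
  have hpi := Real.pi_gt_three
  -- One constant serves both estimates: the summand N is needed for the pointwise one, √π for the
  -- total mass.
  refine ⟨M * √(Real.pi / l) * (N + √Real.pi), by positivity, l, hlpos,
    fun d r T hd0 hd hr0 hr hT => ⟨fun x => ?_, ?_⟩⟩
  · have hker : ∀ s, ‖modulatedKernel v s x‖
        ≤ Real.exp (-x ^ 2 / (2 * v + 1)) * Real.exp (-(2 * l) * s ^ 2) := fun s =>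
      norm_modulatedKernel_le hv s x
    have hint : ∀ {m : ℝ → ℂ} {c : ℝ}, Continuous m → (∀ s, ‖m s‖ ≤ c) →
        Integrable fun s => m s * modulatedKernel v s x := fun hm hc =>
      (((integrable_exp_neg_mul_sq (b := 2 * l) (by positivity)).const_mul _).mono'
        (continuous_modulatedKernel v x).aestronglyMeasurable
        (Eventually.of_forall hker)).bdd_mul hm.aestronglyMeasurable (Eventually.of_forall hc)
    have hfull : ∫ s, (multiplier d r s - 1) * modulatedKernel v s x
        = (2 * Real.pi * (normalDensity d √(v + r) x - normalDensity 0 √v x) : ℝ) := by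
      simp_rw [sub_mul]
      have h1 := integral_multiplier_mul_modulatedKernel hv hr0 (by linarith) d x
      have h0 := integral_multiplier_mul_modulatedKernel hv le_rfl (by norm_num) 0 x
      simp only [multiplier_zero, add_zero] at h0
      rw [integral_sub (hint (continuous_multiplier d r) (norm_multiplier_le hd0 hd hr0 hr))
        (hint (m := fun _ => 1) (c := 1) continuous_const (by simp)), h1, h0]
      push_cast
      ring
    have htail := norm_integral_sub_intervalIntegral_le
      (f := fun s => (multiplier d r s - 1) * modulatedKernel v s x)
      ((continuous_multiplier_sub_one d r).mul (continuous_modulatedKernel v x)) hlpos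
      (D := M * Real.exp (-x ^ 2 / (2 * v + 1)))
      (fun s => by
        rw [norm_mul, mul_assoc]
        gcongr
        · exact norm_multiplier_sub_one_le_const hd0 hd hr0 hr s
        · exact hker s) hT
    rw [← Real.norm_eq_abs, ← Complex.norm_real, Complex.ofReal_sub,
      integral_normalDensity_mul_perturbation d r hT hv, norm_sub_rev]
    have e : ((normalDensity d √(v + r) x - normalDensity 0 √v x : ℝ) : ℂ)
        = (2 * Real.pi : ℂ)⁻¹ * ∫ s, (multiplier d r s - 1) * modulatedKernel v s x := by
      rw [hfull, Complex.ofReal_mul (2 * Real.pi)]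
      have : (2 * Real.pi : ℂ) ≠ 0 := by exact_mod_cast (by positivity : (2 * Real.pi) ≠ 0)
      push_cast
      field_simp
    rw [e, ← mul_sub, norm_mul]
    have h2pi : ‖(2 * Real.pi : ℂ)⁻¹‖ ≤ 1 := by
      rw [norm_inv, norm_mul, Complex.norm_real, Real.norm_of_nonneg Real.pi_pos.le,
        Complex.norm_ofNat]
      exact inv_le_one_of_one_le₀ (by linarith)
    -- As 2v + 1 ≤ 2(v + 1), the decay of the kernel in x is absorbed by the density of N(0, v + 1),
    -- which is the nonnull component of the models to be compared.
    have hx : Real.exp (-x ^ 2 / (2 * v + 1)) ≤ N * normalDensity 0 √(v + 1) x := by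
      rw [normalDensity_sqrt (by positivity), ← hN, ← mul_assoc, mul_inv_cancel₀ hNpos.ne', one_mul,
        sub_zero, Real.exp_le_exp, neg_div, neg_div, neg_le_neg_iff]
      gcongr
      linarith
    have hnd := (normalDensity_pos (u := 0) (Real.sqrt_pos.2 (by positivity : 0 < v + 1)) x).le
    calc _ ≤ 1 * (M * Real.exp (-x ^ 2 / (2 * v + 1)) * √(Real.pi / l) * Real.exp (-l * T ^ 2)) := by
          gcongr
      _ ≤ 1 * (M * ((N + √Real.pi) * normalDensity 0 √(v + 1) x) * √(Real.pi / l)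
          * Real.exp (-l * T ^ 2)) := by
          gcongr
          refine hx.trans ?_
          gcongr
          linarith [Real.sqrt_nonneg Real.pi]
      _ = _ := by ring
  · have hker : ∀ s : ℝ, Real.exp (-s ^ 2 / 4) ≤ Real.exp (-(2 * l) * s ^ 2) := fun s => by
      rw [Real.exp_le_exp]
      have : l ≤ 1 / 8 := by
        rw [hl, div_le_iff₀ (by positivity)]; linarith
      nlinarith [sq_nonneg s]
    have hf : ∀ s : ℝ, ‖(multiplier d r s - 1) * ((√Real.pi * Real.exp (-s ^ 2 / 4) : ℝ) : ℂ)‖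
        ≤ M * √Real.pi * Real.exp (-(2 * l) * s ^ 2) := fun s => by
      rw [norm_mul, Complex.norm_real, Real.norm_of_nonneg (by positivity), mul_assoc]
      gcongr
      · exact norm_multiplier_sub_one_le_const hd0 hd hr0 hr s
      · exact Real.exp_le_exp.1 (hker s)
    have hint : ∀ {m : ℝ → ℂ} {c : ℝ}, Continuous m → (∀ s, ‖m s‖ ≤ c) →
        Integrable fun s => m s * Real.exp (-s ^ 2 / 4) := fun hm hc => by
      have h4 := (integrable_exp_neg_mul_sq (b := 1 / 4) (by norm_num)).ofReal (𝕜 := ℂ)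
      have := h4.bdd_mul hm.aestronglyMeasurable (Eventually.of_forall hc)
      refine this.congr (Eventually.of_forall fun s => ?_)
      dsimp only
      rw [show -(1 / 4) * s ^ 2 = -s ^ 2 / 4 by ring]
      rfl
    have hfull : ∫ s : ℝ, (multiplier d r s - 1) * ((√Real.pi * Real.exp (-s ^ 2 / 4) : ℝ) : ℂ)
        = 0 := by
      have h1 := integral_multiplier_mul_exp (show r < 1 / 2 by linarith) d
      have h0 := integral_multiplier_mul_exp (show (0 : ℝ) < 1 / 2 by norm_num) 0
      simp only [multiplier_zero] at h0
      have e : ∀ s : ℝ, (multiplier d r s - 1) * ((√Real.pi * Real.exp (-s ^ 2 / 4) : ℝ) : ℂ)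
          = √Real.pi * (multiplier d r s * Real.exp (-s ^ 2 / 4) - 1 * Real.exp (-s ^ 2 / 4)) :=
        fun s => by push_cast; ring
      simp_rw [e]
      rw [integral_const_mul,
        integral_sub (hint (continuous_multiplier d r) (norm_multiplier_le hd0 hd hr0 hr))
        (hint (m := fun _ => 1) (c := 1) continuous_const (by simp)), h1, h0, sub_self, mul_zero]
    have htail := norm_integral_sub_intervalIntegral_le
      (f := fun s => (multiplier d r s - 1) * ((√Real.pi * Real.exp (-s ^ 2 / 4) : ℝ) : ℂ))
      ((continuous_multiplier_sub_one d r).mul (by fun_prop)) hlpos hf hT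
    rw [hfull, zero_sub, norm_neg] at htail
    rw [← Real.norm_eq_abs, ← Complex.norm_real, ofReal_integral_perturbation d r hT, norm_mul]
    have h2pi : ‖(2 * Real.pi : ℂ)⁻¹‖ ≤ 1 := by
      rw [norm_inv, norm_mul, Complex.norm_real, Real.norm_of_nonneg Real.pi_pos.le,
        Complex.norm_ofNat]
      exact inv_le_one_of_one_le₀ (by linarith)
    calc _ ≤ 1 * (M * √Real.pi * √(Real.pi / l) * Real.exp (-l * T ^ 2)) := by gcongr
      _ ≤ 1 * (M * (N + √Real.pi) * √(Real.pi / l) * Real.exp (-l * T ^ 2)) := by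
          gcongr
          linarith
      _ = _ := by ring

/-! ### Rapidly decaying characteristic functions -/

/-- `f` is differentiable, and `f` and its derivative decay at `+∞` faster than any power. -/
def RapidDecay (f : ℝ → ℂ) : Prop :=
  Differentiable ℝ f ∧ (∀ k : ℝ, Tendsto (fun t => |t| ^ k * ‖f t‖) atTop (𝓝 0)) ∧
    ∀ k : ℝ, Tendsto (fun t => |t| ^ k * ‖deriv f t‖) atTop (𝓝 0)

lemma tendsto_rpow_mul_norm_zero {f : ℝ → ℂ} {C b : ℝ} (hb : 0 < b)
    (h : ∀ᶠ t in atTop, ‖f t‖ ≤ C * (t * Real.exp (-b * t))) (k : ℝ) :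
    Tendsto (fun t => |t| ^ k * ‖f t‖) atTop (𝓝 0) := by
  have h0 := (tendsto_rpow_mul_exp_neg_mul_atTop_nhds_zero (k + 1) b hb).const_mul C
  rw [mul_zero] at h0
  refine squeeze_zero' (Eventually.of_forall fun t => by positivity) ?_ h0
  filter_upwards [h, eventually_gt_atTop 0] with t ht ht0
  rw [abs_of_pos ht0, Real.rpow_add ht0, Real.rpow_one]
  calc t ^ k * ‖f t‖ ≤ t ^ k * (C * (t * Real.exp (-b * t))) := by gcongr
    _ = _ := by ring

lemma tendsto_rpow_mul_norm_add {f g : ℝ → ℂ} {k : ℝ}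
    (hf : Tendsto (fun t => |t| ^ k * ‖f t‖) atTop (𝓝 0))
    (hg : Tendsto (fun t => |t| ^ k * ‖g t‖) atTop (𝓝 0)) :
    Tendsto (fun t => |t| ^ k * ‖f t + g t‖) atTop (𝓝 0) := by
  have := hf.add hg
  rw [add_zero] at this
  refine squeeze_zero (fun t => by positivity) (fun t => ?_) this
  rw [← mul_add]
  gcongr
  exact norm_add_le _ _

lemma tendsto_rpow_mul_norm_const_mul {f : ℝ → ℂ} {k : ℝ} (c : ℂ)
    (hf : Tendsto (fun t => |t| ^ k * ‖f t‖) atTop (𝓝 0)) :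
    Tendsto (fun t => |t| ^ k * ‖c * f t‖) atTop (𝓝 0) := by
  have := hf.const_mul ‖c‖
  rw [mul_zero] at this
  refine this.congr fun t => ?_
  rw [norm_mul]; ring

lemma RapidDecay.add {f g : ℝ → ℂ} (hf : RapidDecay f) (hg : RapidDecay g) :
    RapidDecay fun t => f t + g t := by
  refine ⟨hf.1.add hg.1, fun k => tendsto_rpow_mul_norm_add (hf.2.1 k) (hg.2.1 k), fun k => ?_⟩
  have := tendsto_rpow_mul_norm_add (hf.2.2 k) (hg.2.2 k)
  refine this.congr fun t => ?_
  rw [← deriv_fun_add (hf.1 t) (hg.1 t)]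

lemma RapidDecay.const_mul {f : ℝ → ℂ} (c : ℂ) (hf : RapidDecay f) :
    RapidDecay fun t => c * f t := by
  refine ⟨hf.1.const_mul c, fun k => tendsto_rpow_mul_norm_const_mul c (hf.2.1 k), fun k => ?_⟩
  refine (tendsto_rpow_mul_norm_const_mul c (hf.2.2 k)).congr fun t => ?_
  rw [← deriv_const_mul c (hf.1 t)]

lemma rapidDecay_gaussian (d : ℝ) {τ : ℝ} (hτ : 0 < τ) :
    RapidDecay fun t : ℝ => Complex.exp ((-(τ * t ^ 2) / 2 : ℝ) - Complex.I * (d * t : ℝ)) := by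
  have hder : ∀ t : ℝ, HasDerivAt
      (fun t : ℝ => Complex.exp ((-(τ * t ^ 2) / 2 : ℝ) - Complex.I * (d * t : ℝ)))
      (Complex.exp ((-(τ * t ^ 2) / 2 : ℝ) - Complex.I * (d * t : ℝ)) *
        ((-(τ * t) : ℝ) - Complex.I * (d : ℝ))) t := fun t => by
    refine HasDerivAt.cexp (HasDerivAt.sub (HasDerivAt.ofReal_comp ?_)
      (HasDerivAt.const_mul _ (HasDerivAt.ofReal_comp ?_)))
    · have := (((hasDerivAt_pow 2 t).const_mul τ).neg).div_const 2
      refine this.congr_deriv ?_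
      push_cast
      ring
    · simpa using (hasDerivAt_id t).const_mul d
  have hexp : ∀ t : ℝ, 1 ≤ t → Real.exp (-(τ * t ^ 2) / 2) ≤ Real.exp (-(τ / 2) * t) := by
    intro t ht
    rw [Real.exp_le_exp]
    nlinarith [mul_le_mul_of_nonneg_left (show t ≤ t ^ 2 by nlinarith) hτ.le]
  refine ⟨fun t => (hder t).differentiableAt,
    tendsto_rpow_mul_norm_zero (C := 1) (b := τ / 2) (by positivity) ?_,
    tendsto_rpow_mul_norm_zero (C := τ + |d|) (b := τ / 2) (by positivity) ?_⟩
  · filter_upwards [eventually_ge_atTop 1] with t ht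
    rw [norm_cexp_sub_I, one_mul]
    refine (hexp t ht).trans (le_mul_of_one_le_left (by positivity) ht)
  · filter_upwards [eventually_ge_atTop 1] with t ht
    rw [(hder t).deriv, norm_mul, norm_cexp_sub_I]
    have hn : ‖((-(τ * t) : ℝ) - Complex.I * (d : ℝ) : ℂ)‖ ≤ (τ + |d|) * t := by
      refine (norm_sub_le _ _).trans ?_
      rw [norm_mul, Complex.norm_I, Complex.norm_real, Complex.norm_real, Real.norm_eq_abs,
        Real.norm_eq_abs, abs_neg, abs_of_nonneg (by positivity)]
      nlinarith [abs_nonneg d]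
    calc _ ≤ Real.exp (-(τ / 2) * t) * ((τ + |d|) * t) := by
          exact mul_le_mul (hexp t ht) hn (norm_nonneg _) (Real.exp_pos _).le
      _ = _ := by ring

/-- The Gaussians are centred at -s with |s| ≤ T. For t ≥ 2T + 1 this gives s + t ≥ t/2, so every
one of them is at most exp(-t/16). -/
lemma rapidDecay_truncated_superposition {μ : ℝ → ℂ} (hμ : Continuous μ) {T : ℝ} (hT : 0 ≤ T) :
    RapidDecay fun t : ℝ => ∫ s in -T..T, μ s * ((√Real.pi * Real.exp (-(s + t) ^ 2 / 4) : ℝ) : ℂ) := by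
  obtain ⟨M, hM⟩ := (isCompact_Icc (a := -T) (b := T)).exists_bound_of_continuousOn
    hμ.continuousOn
  have hM0 : 0 ≤ M := (norm_nonneg _).trans (hM 0 ⟨by linarith, hT⟩)
  have hM' : ∀ s ∈ uIoc (-T) T, ‖μ s‖ ≤ M := fun s hs => by
    rw [uIoc_of_le (by linarith)] at hs
    exact hM s (Ioc_subset_Icc_self hs)
  have hder : ∀ t : ℝ, HasDerivAt
      (fun t : ℝ => ∫ s in -T..T, μ s * ((√Real.pi * Real.exp (-(s + t) ^ 2 / 4) : ℝ) : ℂ))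
      (∫ s in -T..T, μ s * ((√Real.pi * (Real.exp (-(s + t) ^ 2 / 4) * (-(s + t) / 2)) : ℝ) : ℂ))
      t := fun t => by
    refine (intervalIntegral.hasDerivAt_integral_of_dominated_loc_of_deriv_le
      (F := fun t s => μ s * ((√Real.pi * Real.exp (-(s + t) ^ 2 / 4) : ℝ) : ℂ))
      (F' := fun t s => μ s * ((√Real.pi * (Real.exp (-(s + t) ^ 2 / 4) * (-(s + t) / 2)) : ℝ) : ℂ))
      (bound := fun _ => M * (√Real.pi * 1)) (s := univ) univ_mem
      (Eventually.of_forall fun t => ?_) ?_ ?_ ?_ ?_ ?_).2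
    · exact Continuous.aestronglyMeasurable (by fun_prop)
    · exact Continuous.intervalIntegrable (by fun_prop) _ _
    · exact Continuous.aestronglyMeasurable (by fun_prop)
    · refine Eventually.of_forall fun s hs y _ => ?_
      rw [norm_mul, Complex.norm_real, Real.norm_eq_abs, abs_mul, abs_mul,
        abs_of_nonneg (Real.sqrt_nonneg _), Real.abs_exp]
      gcongr
      · exact hM' s hs
      -- From |x|/2 ≤ 1 + x²/4 ≤ exp(x²/4), the derivative has a bound uniform in t, so domination
      -- holds on the whole line.
      · rw [neg_div ((4 : ℝ)), Real.exp_neg, inv_mul_le_one₀ (Real.exp_pos _), neg_div, abs_neg]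
        have h1 := Real.add_one_le_exp ((s + y) ^ 2 / 4)
        refine le_trans ?_ h1
        refine abs_le.2 ⟨?_, ?_⟩ <;> nlinarith [sq_nonneg (s + y - 1), sq_nonneg (s + y + 1)]
    · exact intervalIntegrable_const
    · refine Eventually.of_forall fun s _ y _ => ?_
      refine HasDerivAt.const_mul _ (HasDerivAt.ofReal_comp (HasDerivAt.const_mul _
        (HasDerivAt.exp ?_)))
      have := ((((hasDerivAt_id y).const_add s).pow 2).neg).div_const 4
      refine this.congr_deriv ?_
      simp
      ring
  have hexp : ∀ t, 2 * T + 1 ≤ t → ∀ s ∈ uIoc (-T) T,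
      Real.exp (-(s + t) ^ 2 / 4) ≤ Real.exp (-(1 / 16) * t) := fun t ht s hs => by
    rw [uIoc_of_le (by linarith)] at hs
    rw [Real.exp_le_exp]
    have h1 : t / 2 ≤ s + t := by linarith [hs.1]
    nlinarith [mul_self_le_mul_self (by linarith : 0 ≤ t / 2) h1]
  refine ⟨fun t => (hder t).differentiableAt,
    tendsto_rpow_mul_norm_zero (C := M * √Real.pi * |T - -T|) (b := 1 / 16) (by positivity) ?_,
    tendsto_rpow_mul_norm_zero (C := M * √Real.pi * |T - -T|) (b := 1 / 16) (by positivity) ?_⟩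
  · filter_upwards [eventually_ge_atTop (2 * T + 1)] with t ht
    have := intervalIntegral.norm_integral_le_of_norm_le_const (a := -T) (b := T)
      (f := fun s => μ s * ((√Real.pi * Real.exp (-(s + t) ^ 2 / 4) : ℝ) : ℂ))
      (C := M * (√Real.pi * (t * Real.exp (-(1 / 16) * t)))) fun s hs => by
        rw [norm_mul, Complex.norm_real, Real.norm_of_nonneg (by positivity)]
        gcongr
        · exact hM' s hs
        · refine (hexp t ht s hs).trans (le_mul_of_one_le_left (by positivity) (by linarith))
    refine this.trans (le_of_eq (by ring))
  · filter_upwards [eventually_ge_atTop (2 * T + 1)] with t ht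
    rw [(hder t).deriv]
    have := intervalIntegral.norm_integral_le_of_norm_le_const (a := -T) (b := T)
      (f := fun s => μ s *
        ((√Real.pi * (Real.exp (-(s + t) ^ 2 / 4) * (-(s + t) / 2)) : ℝ) : ℂ))
      (C := M * (√Real.pi * (Real.exp (-(1 / 16) * t) * t))) fun s hs => by
        rw [norm_mul, Complex.norm_real, Real.norm_eq_abs, abs_mul, abs_mul,
          abs_of_nonneg (Real.sqrt_nonneg _), Real.abs_exp]
        have hs' := hs
        rw [uIoc_of_le (by linarith)] at hs'
        gcongr
        · exact hM' s hs
        · exact Real.exp_le_exp.1 (hexp t ht s hs)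
        · exact abs_le.2 ⟨by linarith [hs'.1, hs'.2], by linarith [hs'.1, hs'.2]⟩
    refine this.trans (le_of_eq (by ring))

lemma integral_cexp_mul_normalDensity (u0 : ℝ) {τ : ℝ} (hτ : 0 < τ) (t : ℝ) :
    ∫ u : ℝ, Complex.exp (Complex.I * t * u) * (normalDensity u0 √τ u : ℂ)
      = Complex.exp ((-(τ * t ^ 2) / 2 : ℝ) - Complex.I * (-u0 * t : ℝ)) := by
  have h := integral_cexp_quadratic_ofReal (b := 1 / (2 * τ)) (by positivity)
    (Complex.I * t + u0 / τ) (-u0 ^ 2 / (2 * τ))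
  have hτ' : (τ : ℂ) ≠ 0 := by exact_mod_cast hτ.ne'
  calc _ = ∫ u : ℝ, ((√(2 * Real.pi * τ))⁻¹ : ℝ) * Complex.exp (-(1 / (2 * τ) : ℝ) * u ^ 2
        + (Complex.I * t + u0 / τ) * u + -u0 ^ 2 / (2 * τ)) := by
        congr 1; ext u
        rw [normalDensity_sqrt hτ, Complex.ofReal_mul, Complex.ofReal_exp, mul_left_comm,
          ← Complex.exp_add]
        congr 2
        push_cast
        field_simp
        ring
    _ = _ := by
        rw [integral_const_mul, h, ← mul_assoc, ← Complex.ofReal_mul,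
          show Real.pi / (1 / (2 * τ)) = 2 * Real.pi * τ by field_simp,
          inv_mul_cancel₀ (by positivity), Complex.ofReal_one, one_mul]
        congr 1
        push_cast
        field_simp
        ring_nf
        simp only [Complex.I_sq]
        ring

lemma integral_normalDensity_mul_normalDensity {v τ : ℝ} (hv : 0 < v) (hτ : 0 < τ) (x : ℝ) :
    ∫ u, normalDensity u √v x * normalDensity 0 √τ u = normalDensity 0 √(v + τ) x := by
  have h := integral_gaussian_conv hv hτ x 0
  simp only [Complex.ofReal_zero, mul_zero, zero_mul, add_zero, ← Complex.ofReal_exp,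
    zero_div, ne_eq, OfNat.ofNat_ne_zero, not_false_eq_true, zero_pow, sub_zero,
    ← Complex.ofReal_mul] at h
  rw [integral_complex_ofReal, Complex.ofReal_inj] at h
  calc _ = ∫ u, (√(2 * Real.pi * v))⁻¹ * (√(2 * Real.pi * τ))⁻¹ *
        Real.exp (-(x - u) ^ 2 / (2 * v) - u ^ 2 / (2 * τ)) := by
        congr 1; ext u
        rw [normalDensity_sqrt hv, normalDensity_sqrt hτ, sub_zero, sub_eq_add_neg (_ / _) (_ / _),
          Real.exp_add, neg_div (2 * τ)]
        ring
    _ = _ := by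
        rw [integral_const_mul, h, normalDensity_sqrt (by positivity), sub_zero, ← mul_assoc]
        congr 1
        rw [← Real.sqrt_inv, ← Real.sqrt_inv, ← Real.sqrt_inv, ← Real.sqrt_mul (by positivity),
          ← Real.sqrt_mul (by positivity)]
        congr 1
        field_simp

/-! ### Eligible models with a single nonnull scale -/

lemma isProbabilityMeasure_withDensity_ofReal {k : ℝ → ℝ}
    (hk1 : ∫⁻ u, ENNReal.ofReal (k u) = 1) :
    IsProbabilityMeasure (volume.withDensity fun u => ENNReal.ofReal (k u)) :=
  ⟨by rw [withDensity_apply _ MeasurableSet.univ, Measure.restrict_univ, hk1]⟩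

/-- The eligible model in which every nonnull effect has the null scale `σ0`, and a mean with
density `k`. -/
noncomputable def singleScaleModel {ε : ℝ} (u0 : ℝ) {σ0 : ℝ} {k : ℝ → ℝ} (hε0 : 0 < ε)
    (hε1 : ε < 1) (hσ0 : 0 < σ0) (hk : Measurable k) (hk0 : ∀ u, 0 ≤ k u)
    (hk1 : ∫⁻ u, ENNReal.ofReal (k u) = 1) : EligibleModel :=
  have hprob : IsProbabilityMeasure (volume.withDensity fun u => ENNReal.ofReal (k u)) :=
    isProbabilityMeasure_withDensity_ofReal hk1
  have hsnd : ((volume.withDensity fun u => ENNReal.ofReal (k u)).prod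
      (Measure.dirac σ0)).map Prod.snd = Measure.dirac σ0 := by
    rw [← Measure.snd, Measure.snd_prod]
  { ε := ε
    u0 := u0
    σ0 := σ0
    H := (volume.withDensity fun u => ENNReal.ofReal (k u)).prod (Measure.dirac σ0)
    -- The same density is used at every σ, also where the Dirac marginal has no mass, so the
    -- suprema over σ run over a constant.
    h := fun _ u => k u
    ε_pos := hε0
    ε_lt_one := hε1
    σ0_pos := hσ0
    prob_H := inferInstance
    supp_H := by rw [hsnd, Measure.dirac_apply' _ measurableSet_Iio]; simp
    meas_h := hk.comp measurable_snd
    h_nonneg := fun _ _ => hk0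
    h_integral := fun _ _ => hk1
    disint := by rw [hsnd, prod_withDensity_left (by fun_prop)] }

section singleScaleModel

variable {ε u0 σ0 : ℝ} {k : ℝ → ℝ} (hε0 : 0 < ε) (hε1 : ε < 1) (hσ0 : 0 < σ0) (hk : Measurable k)
  (hk0 : ∀ u, 0 ≤ k u) (hk1 : ∫⁻ u, ENNReal.ofReal (k u) = 1)

lemma singleScaleModel_density (x : ℝ) :
    (singleScaleModel u0 hε0 hε1 hσ0 hk hk0 hk1).density x
      = (1 - ε) * normalDensity u0 σ0 x + ε * ∫ u, normalDensity u σ0 x * k u := by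
  have hprob : IsProbabilityMeasure (volume.withDensity fun u => ENNReal.ofReal (k u)) :=
    isProbabilityMeasure_withDensity_ofReal hk1
  rw [EligibleModel.density]
  congr 2
  change ∫ p : ℝ × ℝ, normalDensity p.1 p.2 x ∂((volume.withDensity fun u =>
    ENNReal.ofReal (k u)).prod (Measure.dirac σ0)) = _
  have hmeas : Measurable fun p : ℝ × ℝ => normalDensity p.1 p.2 x := by
    unfold normalDensity gaussianPDFReal; fun_prop
  rw [Measure.prod_dirac, integral_map (by fun_prop) hmeas.aestronglyMeasurable,
    integral_withDensity_eq_integral_toReal_smul (by fun_prop)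
      (Eventually.of_forall fun _ => ENNReal.ofReal_lt_top)]
  congr 1; ext u
  rw [ENNReal.toReal_ofReal (hk0 u), smul_eq_mul, mul_comm]

lemma singleScaleModel_hHat (σ : ℝ) :
    (singleScaleModel u0 hε0 hε1 hσ0 hk hk0 hk1).hHat σ
      = fun t : ℝ => ∫ u : ℝ, Complex.exp (Complex.I * t * u) * (k u : ℂ) := rfl

lemma singleScaleModel_hTilde (σ : ℝ) :
    (singleScaleModel u0 hε0 hε1 hσ0 hk hk0 hk1).hTilde σ
      = fun t : ℝ => ∫ u : ℝ, Complex.exp (Complex.I * t * u) * (k (u + u0) : ℂ) := rfl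

/-- For a fixed model both limsups are zero, so no quantitative control in T is needed. -/
lemma singleScaleModel_smoothnessCondition {α A : ℝ}
    (h1 : RapidDecay fun t : ℝ => ∫ u : ℝ, Complex.exp (Complex.I * t * u) * (k u : ℂ))
    (h2 : RapidDecay fun t : ℝ => ∫ u : ℝ, Complex.exp (Complex.I * t * u) * (k (u + u0) : ℂ)) :
    (singleScaleModel u0 hε0 hε1 hσ0 hk hk0 hk1).SmoothnessCondition α A := by
  have key : ∀ {f : ℝ → ℝ}, Tendsto f atTop (𝓝 0) →
      limsup (fun t : ℝ => ⨆ _ ∈ Ici σ0, ENNReal.ofReal (f t)) atTop ≤ ENNReal.ofReal A := by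
    intro f hf
    have h0 : limsup (fun t => ENNReal.ofReal (f t)) atTop = 0 := by
      have := (ENNReal.tendsto_ofReal hf).limsup_eq
      rwa [ENNReal.ofReal_zero] at this
    calc _ ≤ limsup (fun t => ENNReal.ofReal (f t)) atTop :=
          limsup_le_limsup (Eventually.of_forall fun t => iSup₂_le fun _ _ => le_rfl)
      _ ≤ _ := by simp [h0]
  unfold EligibleModel.SmoothnessCondition
  simp only [singleScaleModel_hHat, singleScaleModel_hTilde]
  exact ⟨key (h1.2.1 α), Eventually.of_forall fun t _ _ => h2.1 t, key (h2.2.2 (α + 1))⟩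

lemma singleScaleModel_mem_paramSpace {α ε1 q a A : ℝ} (haσ : a ≤ σ0) (hε : ε ≤ ε1)
    (hmom : ∫⁻ x, ENNReal.ofReal (|x| ^ q *
      (singleScaleModel u0 hε0 hε1 hσ0 hk hk0 hk1).density x) ≤ ENNReal.ofReal (A ^ q))
    (h1 : RapidDecay fun t : ℝ => ∫ u : ℝ, Complex.exp (Complex.I * t * u) * (k u : ℂ))
    (h2 : RapidDecay fun t : ℝ => ∫ u : ℝ, Complex.exp (Complex.I * t * u) * (k (u + u0) : ℂ)) :
    singleScaleModel u0 hε0 hε1 hσ0 hk hk0 hk1 ∈ paramSpace α ε1 q a A ε :=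
  ⟨⟨haσ, hmom⟩, singleScaleModel_smoothnessCondition hε0 hε1 hσ0 hk hk0 hk1 h1 h2, le_rfl, hε⟩

end singleScaleModel

/-- The dominating centred Gaussians have total weight 1 + B, and neither has a larger absolute
moment than the wider one. -/
lemma lintegral_absMoment_le {f : ℝ → ℝ} {v w ε B q A : ℝ} (hv : 0 < v) (hvw : v ≤ w)
    (hq : 0 < q) (hε0 : 0 ≤ ε) (hε1 : ε ≤ 1) (hB : 0 ≤ B)
    (hf : ∀ x, f x ≤ (1 - ε) * normalDensity 0 √v x + (ε + B) * normalDensity 0 √w x)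
    (hA : (1 + B) * (√w ^ q * normalAbsMoment q) ≤ A ^ q) :
    ∫⁻ x, ENNReal.ofReal (|x| ^ q * f x) ≤ ENNReal.ofReal (A ^ q) := by
  have hw : 0 < w := hv.trans_le hvw
  have hM := normalAbsMoment_nonneg q
  have hmeas : ∀ σ, Measurable fun x => ENNReal.ofReal (|x| ^ q * normalDensity 0 σ x) := fun σ => by
    have := (continuous_normalDensity 0 σ).measurable
    fun_prop
  calc ∫⁻ x, ENNReal.ofReal (|x| ^ q * f x)
      ≤ ∫⁻ x, (ENNReal.ofReal (1 - ε) * ENNReal.ofReal (|x| ^ q * normalDensity 0 √v x)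
        + ENNReal.ofReal (ε + B) * ENNReal.ofReal (|x| ^ q * normalDensity 0 √w x)) := by
        refine lintegral_mono fun x => ?_
        have h1 := (normalDensity_pos (u := 0) (Real.sqrt_pos.2 hv) x).le
        have h2 := (normalDensity_pos (u := 0) (Real.sqrt_pos.2 hw) x).le
        have h3 : 0 ≤ 1 - ε := by linarith
        rw [← ENNReal.ofReal_mul h3, ← ENNReal.ofReal_mul (by linarith),
          ← ENNReal.ofReal_add (by positivity) (by positivity)]
        refine ENNReal.ofReal_le_ofReal ?_
        calc |x| ^ q * f x ≤ |x| ^ q * _ := mul_le_mul_of_nonneg_left (hf x) (by positivity)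
          _ = _ := by ring
    _ = ENNReal.ofReal ((1 - ε) * (√v ^ q * normalAbsMoment q)
          + (ε + B) * (√w ^ q * normalAbsMoment q)) := by
        have h3 : 0 ≤ 1 - ε := by linarith
        rw [lintegral_add_left ((hmeas _).const_mul _), lintegral_const_mul _ (hmeas _),
          lintegral_const_mul _ (hmeas _), lintegral_absMoment (Real.sqrt_pos.2 hv) hq,
          lintegral_absMoment (Real.sqrt_pos.2 hw) hq, ENNReal.ofReal_add (mul_nonneg h3 (by positivity))
          (by positivity), ENNReal.ofReal_mul h3, ENNReal.ofReal_mul (p := ε + B) (by linarith)]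
    _ ≤ _ := by
        refine ENNReal.ofReal_le_ofReal (le_trans ?_ hA)
        have h3 : 0 ≤ 1 - ε := by linarith
        have : √v ^ q * normalAbsMoment q ≤ √w ^ q * normalAbsMoment q := by gcongr
        nlinarith

/-! ### The perturbed nonnull density -/

/-- The standard normal density plus `c` times the perturbation, renormalised. -/
noncomputable def perturbedNormal (c d r T u : ℝ) : ℝ :=
  (1 - c * ∫ u', perturbation d r T u') * normalDensity 0 √1 u + c * perturbation d r T u

lemma continuous_perturbedNormal (c d r T : ℝ) : Continuous (perturbedNormal c d r T) :=
  ((continuous_normalDensity _ _).const_mul _).add ((continuous_perturbation d r T).const_mul _)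

/-- The envelope exp(-u²) decays faster than the standard normal density, so the perturbation is
small relative to that density at every u. One ρ pays for the perturbation, the other for the
renormalisation. -/
lemma abs_perturbedNormal_sub_le {c d r T b ρ : ℝ} (hc : 0 ≤ c) (hT : 0 ≤ T)
    (hb : ∀ s, |s| ≤ T → ‖multiplier d r s - 1‖ ≤ b) (hρ : 3 * c * b * T ≤ ρ) (u : ℝ) :
    |perturbedNormal c d r T u - normalDensity 0 √1 u| ≤ 2 * ρ * normalDensity 0 √1 u := by
  have hb0 : 0 ≤ b := (norm_nonneg _).trans (hb 0 (by simpa using hT))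
  have hs1 : (0 : ℝ) < √1 := by simp
  have hpt : ∀ u, |c * perturbation d r T u| ≤ ρ * normalDensity 0 √1 u := fun u => by
    -- Source of the factor 3 in `hρ`: exp(-u²) is at most √(2π) times the standard normal density.
    have h3 : √(2 * Real.pi) ≤ 3 := by
      rw [Real.sqrt_le_left (by norm_num)]
      linarith [Real.pi_lt_four]
    have hsq : 0 < √(2 * Real.pi) := by positivity
    have he : Real.exp (-u ^ 2) ≤ 3 * normalDensity 0 √1 u := by
      rw [normalDensity_sqrt one_pos, mul_one, sub_zero, mul_one, ← mul_assoc, ← div_eq_mul_inv]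
      have h1 : 1 ≤ 3 / √(2 * Real.pi) := by rwa [one_le_div hsq]
      refine le_trans ?_ (le_mul_of_one_le_left (by positivity) h1)
      rw [Real.exp_le_exp]
      nlinarith [sq_nonneg u]
    have hn := (normalDensity_pos (u := 0) hs1 u).le
    rw [abs_mul, abs_of_nonneg hc]
    calc c * |perturbation d r T u| ≤ c * (b * T * (3 * normalDensity 0 √1 u)) := by
          gcongr
          exact (abs_perturbation_le hT hb u).trans (by gcongr)
      _ = 3 * c * b * T * normalDensity 0 √1 u := by ring
      _ ≤ _ := by gcongr
  have hz : |c * ∫ u, perturbation d r T u| ≤ ρ := by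
    rw [← integral_const_mul]
    refine (norm_integral_le_of_norm_le (f := fun u => c * perturbation d r T u)
      ((integrable_normalDensity hs1).const_mul ρ)
      (Eventually.of_forall hpt)).trans ?_
    rw [integral_const_mul, integral_normalDensity hs1, mul_one]
  have hn := (normalDensity_pos (u := 0) hs1 u).le
  calc _ = |-(c * ∫ u, perturbation d r T u) * normalDensity 0 √1 u
        + c * perturbation d r T u| := by rw [perturbedNormal]; congr 1; ring
    _ ≤ ρ * normalDensity 0 √1 u + ρ * normalDensity 0 √1 u := by
        refine (abs_add_le _ _).trans (add_le_add ?_ (hpt u))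
        rw [abs_mul, abs_neg, abs_of_nonneg hn]
        gcongr
    _ = _ := by ring

lemma integrable_perturbedNormal (c d r : ℝ) {T : ℝ} (hT : 0 ≤ T) :
    Integrable (perturbedNormal c d r T) :=
  ((integrable_normalDensity (by simp)).const_mul _).add
    ((integrable_perturbation d r T hT).const_mul _)

lemma integral_perturbedNormal (c d r : ℝ) {T : ℝ} (hT : 0 ≤ T) :
    ∫ u, perturbedNormal c d r T u = 1 := by
  unfold perturbedNormal
  rw [integral_add ((integrable_normalDensity (by simp)).const_mul _)
    ((integrable_perturbation d r T hT).const_mul _), integral_const_mul, integral_const_mul,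
    integral_normalDensity (by simp)]
  ring

lemma rapidDecay_normalDensity (u0 : ℝ) {τ : ℝ} (hτ : 0 < τ) :
    RapidDecay fun t : ℝ => ∫ u : ℝ, Complex.exp (Complex.I * t * u) * (normalDensity u0 √τ u : ℂ) := by
  simp_rw [integral_cexp_mul_normalDensity u0 hτ]
  exact rapidDecay_gaussian _ hτ

lemma rapidDecay_perturbedNormal (c d r : ℝ) {T : ℝ} (hT : 0 ≤ T) :
    RapidDecay fun t : ℝ =>
      ∫ u : ℝ, Complex.exp (Complex.I * t * u) * (perturbedNormal c d r T u : ℂ) := by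
  have hint : ∀ {f : ℝ → ℝ}, Integrable f → ∀ t : ℝ,
      Integrable fun u : ℝ => Complex.exp (Complex.I * t * u) * (f u : ℂ) := fun hf t =>
    hf.ofReal.bdd_mul (c := 1) (Continuous.aestronglyMeasurable (by fun_prop))
      (Eventually.of_forall fun u => (norm_cexp_I_mul_mul t u).le)
  have e : ∀ t : ℝ, ∫ u : ℝ, Complex.exp (Complex.I * t * u) * (perturbedNormal c d r T u : ℂ)
      = ((1 - c * ∫ u', perturbation d r T u' : ℝ) : ℂ) *
          (∫ u : ℝ, Complex.exp (Complex.I * t * u) * (normalDensity 0 √1 u : ℂ))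
        + ((c : ℂ) * (2 * Real.pi : ℂ)⁻¹) * ∫ s in -T..T, (multiplier d r s - 1) *
          ((√Real.pi * Real.exp (-(s + t) ^ 2 / 4) : ℝ) : ℂ) := fun t => by
    rw [mul_assoc (c : ℂ), ← integral_cexp_mul_perturbation d r hT t,
      ← integral_const_mul ((1 - _ : ℝ) : ℂ), ← integral_const_mul (c : ℂ),
      ← integral_add ((hint (integrable_normalDensity (by simp)) t).const_mul _)
        ((hint (integrable_perturbation d r T hT) t).const_mul _)]
    congr 1; ext u
    rw [perturbedNormal]
    push_cast
    ring
  simp_rw [e]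
  exact ((rapidDecay_normalDensity 0 one_pos).const_mul _).add
    ((rapidDecay_truncated_superposition (continuous_multiplier_sub_one d r) hT).const_mul _)

lemma integral_normalDensity_mul_perturbedNormal (c d r : ℝ) {T v : ℝ} (hT : 0 ≤ T) (hv : 0 < v)
    (x : ℝ) :
    ∫ u, normalDensity u √v x * perturbedNormal c d r T u
      = (1 - c * ∫ u', perturbation d r T u') * normalDensity 0 √(v + 1) x
        + c * ∫ u, normalDensity u √v x * perturbation d r T u := by
  have hσ := Real.sqrt_pos.2 hv
  have hint : ∀ {f : ℝ → ℝ}, Integrable f → Integrable fun u => normalDensity u √v x * f u :=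
    fun hf => hf.bdd_mul (continuous_normalDensity_left _ x).aestronglyMeasurable
      (Eventually.of_forall fun u => by
        rw [Real.norm_of_nonneg (normalDensity_pos hσ x).le]; exact normalDensity_le hσ x)
  rw [← integral_normalDensity_mul_normalDensity hv one_pos,
    ← integral_const_mul (1 - _), ← integral_const_mul c (fun u => normalDensity u √v x * _),
    ← integral_add ((hint (integrable_normalDensity (by simp))).const_mul _)
      ((hint (integrable_perturbation d r T hT)).const_mul _)]
  congr 1; ext u
  rw [perturbedNormal]
  ring

/-! ### The minimax lower bounds -/

/-- Both risks are bounded by the same pair of models. The factor 2 in `y` counts the truncation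
error and the renormalisation error; the slack 3ρ in the moment budget is 2ρ for the perturbed
density plus `y ≤ ρ` for passing to the other model. -/
lemma exists_minimaxRisk_lower_bound {a : ℝ} (ha : 0 < a) :
    ∃ K > 0, ∃ l > 0, ∀ (α q A ε1 ε d r T ρ y : ℝ) (n : ℕ), 0 < q → 0 < ε → ε < 1 → ε ≤ ε1 →
      0 ≤ d → 0 ≤ r → 1 ≤ T → ρ ≤ 1 / 2 → 6 * (4 * d * T + 3 * r * T ^ 2) * T ≤ ρ * ε →
      y = 2 * (K * Real.exp (-l * T ^ 2)) → y ≤ ρ → n * y ≤ 1 / 2 →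
      (1 + 3 * ρ) * (√(a ^ 2 + 1) ^ q * normalAbsMoment q) ≤ A ^ q →
      ENNReal.ofReal (r ^ 2 / 8) ≤ minimaxRiskVar n (paramSpace α ε1 q a A ε) ∧
        ENNReal.ofReal (d ^ 2 / 8) ≤ minimaxRiskMean n (paramSpace α ε1 q a A ε) := by
  have hv : 0 < a ^ 2 := by positivity
  obtain ⟨K, hK, l, hl, hbound⟩ := exists_perturbation_error_bound hv
  refine ⟨K, hK, l, hl, fun α q A ε1 ε d r T ρ y n hq hε0 hε1 hεle hd0 hr0 hT hρ hsmall hy hyρ hny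
    hA => ?_⟩
  have hT0 : 0 ≤ T := by linarith
  set b := 2 * (4 * d * T + 3 * r * T ^ 2) with hb
  have hdT : 0 ≤ d * T := by positivity
  have hrT : 0 ≤ r * T ^ 2 := by positivity
  have hb0 : 0 ≤ b := by rw [hb]; nlinarith
  have hbT : b ≤ b * T := le_mul_of_one_le_right hb0 hT
  have hρε : ρ * ε ≤ 1 / 2 := by
    have hy0 : 0 ≤ y := by rw [hy]; positivity
    nlinarith
  have hρ0 : 0 ≤ ρ := by
    have hy0 : 0 ≤ y := by rw [hy]; positivity
    linarith
  have hb1 : b ≤ 1 / 6 := by nlinarith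
  have hd : d ≤ 1 := by nlinarith
  have hr : r ≤ 1 / 4 := by nlinarith [one_le_pow₀ hT (n := 2)]
  have hm : ∀ s, |s| ≤ T → ‖multiplier d r s - 1‖ ≤ b := fun s hs =>
    norm_multiplier_sub_one_le hd0 hd hr0 hr hT hs (by linarith)
  -- A change of the nonnull law carries weight ε and must offset a change of the null law carrying
  -- weight 1 - ε.
  set c := (1 - ε) / ε with hc
  have hc0 : 0 ≤ c := div_nonneg (by linarith) hε0.le
  have hεc : ε * c = 1 - ε := by rw [hc]; field_simp
  have hcb : 3 * c * b * T ≤ ρ := by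
    rw [← mul_le_mul_iff_of_pos_left hε0]
    calc ε * (3 * c * b * T) = 3 * (1 - ε) * (b * T) := by rw [← hεc]; ring
      _ ≤ 3 * 1 * (b * T) := by gcongr; linarith
      _ ≤ ε * ρ := by rw [hb]; linarith
  have hk := abs_perturbedNormal_sub_le hc0 hT0 hm hcb
  have hs1 : (0 : ℝ) < √1 := by simp
  have hw : 0 < a ^ 2 + 1 := by positivity
  have hσ := Real.sqrt_pos.2 hv
  obtain ⟨herr, hint⟩ := hbound d r T hd0 hd hr0 hr hT0
  set G := normalDensity 0 √(a ^ 2 + 1) with hG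
  have hG0 : ∀ x, 0 < G x := normalDensity_pos (Real.sqrt_pos.2 hw)
  -- Positivity is where 2ρ ≤ 1 enters.
  have hk0 : ∀ u, 0 ≤ perturbedNormal c d r T u := fun u => by
    have := (normalDensity_pos (u := 0) hs1 u).le
    have := (abs_le.1 (hk u)).1
    nlinarith
  have hk1 : ∫⁻ u, ENNReal.ofReal (perturbedNormal c d r T u) = 1 := by
    rw [← ofReal_integral_eq_lintegral_ofReal (integrable_perturbedNormal c d r hT0)
      (Eventually.of_forall hk0), integral_perturbedNormal c d r hT0, ENNReal.ofReal_one]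
  have h1r : 0 < 1 - r := by linarith
  have hg0 : ∀ u, 0 ≤ normalDensity 0 √(1 - r) u := fun u =>
    (normalDensity_pos (Real.sqrt_pos.2 h1r) u).le
  have hg1 : ∫⁻ u, ENNReal.ofReal (normalDensity 0 √(1 - r) u) = 1 := by
    rw [← ofReal_integral_eq_lintegral_ofReal (integrable_normalDensity (Real.sqrt_pos.2 h1r))
      (Eventually.of_forall hg0), integral_normalDensity (Real.sqrt_pos.2 h1r), ENNReal.ofReal_one]
  have hvr : 0 < a ^ 2 + r := by linarith
  set θ₁ := singleScaleModel 0 hε0 hε1 hσ (continuous_perturbedNormal c d r T).measurable hk0 hk1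
    with hθ₁
  set θ₂ := singleScaleModel d hε0 hε1 (Real.sqrt_pos.2 hvr)
    (continuous_normalDensity 0 √(1 - r)).measurable hg0 hg1 with hθ₂
  have hf₁ : ∀ x, θ₁.density x = (1 - ε) * normalDensity 0 √(a ^ 2) x
      + ε * ∫ u, normalDensity u √(a ^ 2) x * perturbedNormal c d r T u := fun x =>
    singleScaleModel_density _ _ _ _ _ _ x
  -- The variance r gained by the scale is taken from the means, so the nonnull component stays N(0,
  -- a² + 1).
  have hf₂ : ∀ x, θ₂.density x = (1 - ε) * normalDensity d √(a ^ 2 + r) x + ε * G x := fun x => by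
    rw [hθ₂, singleScaleModel_density, integral_normalDensity_mul_normalDensity hvr h1r,
      show a ^ 2 + r + (1 - r) = a ^ 2 + 1 by ring]
  have hdiff : ∀ x, |θ₁.density x - θ₂.density x| ≤ y * G x := fun x => by
    rw [hf₁, hf₂, integral_normalDensity_mul_perturbedNormal c d r hT0 hv, ← hG]
    have e : (1 - ε) * normalDensity 0 √(a ^ 2) x + ε * ((1 - c * ∫ u, perturbation d r T u) * G x
          + c * ∫ u, normalDensity u √(a ^ 2) x * perturbation d r T u)
          - ((1 - ε) * normalDensity d √(a ^ 2 + r) x + ε * G x)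
        = (1 - ε) * (((∫ u, normalDensity u √(a ^ 2) x * perturbation d r T u)
            - (normalDensity d √(a ^ 2 + r) x - normalDensity 0 √(a ^ 2) x))
          - (∫ u, perturbation d r T u) * G x) := by
      rw [← hεc]
      ring
    have h0 : 0 ≤ 1 - ε := by linarith
    rw [e, abs_mul, abs_of_nonneg h0, hy]
    refine (mul_le_of_le_one_left (abs_nonneg _) (by linarith)).trans ?_
    refine (abs_sub _ _).trans ?_
    rw [abs_mul, abs_of_pos (hG0 x)]
    have h2 := herr x
    have h3 := mul_le_mul_of_nonneg_right hint (hG0 x).le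
    linarith
  have hmom₁ : ∀ x, θ₁.density x ≤ (1 - ε) * normalDensity 0 √(a ^ 2) x + (ε + 2 * ρ) * G x :=
    fun x => by
    have hle : ∫ u, normalDensity u √(a ^ 2) x * perturbedNormal c d r T u
        ≤ (1 + 2 * ρ) * G x := by
      rw [hG, ← integral_normalDensity_mul_normalDensity hv one_pos, ← integral_const_mul]
      have hi : ∀ {f : ℝ → ℝ}, Integrable f → Integrable fun u => normalDensity u √(a ^ 2) x * f u :=
        fun hf => hf.bdd_mul (continuous_normalDensity_left _ x).aestronglyMeasurable
          (Eventually.of_forall fun u => by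
            rw [Real.norm_of_nonneg (normalDensity_pos hσ x).le]; exact normalDensity_le hσ x)
      refine integral_mono (hi (integrable_perturbedNormal c d r hT0))
        ((hi (integrable_normalDensity hs1)).const_mul _) fun u => ?_
      have h2 := (abs_le.1 (hk u)).2
      calc normalDensity u √(a ^ 2) x * perturbedNormal c d r T u
          ≤ normalDensity u √(a ^ 2) x * ((1 + 2 * ρ) * normalDensity 0 √1 u) :=
            mul_le_mul_of_nonneg_left (by linarith) (normalDensity_pos hσ x).le
        _ = _ := by ring
    rw [hf₁]
    have h3 := mul_le_mul_of_nonneg_left hle hε0.le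
    have h4 : ε * (2 * ρ * G x) ≤ 2 * ρ * G x :=
      mul_le_of_le_one_left (mul_nonneg (by linarith) (hG0 x).le) hε1.le
    linarith
  -- Going through the first density keeps the dominating Gaussians centred, although the null mean
  -- is now d.
  have hmom₂ : ∀ x, θ₂.density x ≤ (1 - ε) * normalDensity 0 √(a ^ 2) x + (ε + 3 * ρ) * G x :=
    fun x => by
    have h2 := (abs_le.1 (hdiff x)).1
    have h3 := mul_le_mul_of_nonneg_right hyρ (hG0 x).le
    linarith [hmom₁ x]
  have hmom₁' : ∀ x, θ₁.density x ≤ (1 - ε) * normalDensity 0 √(a ^ 2) x + (ε + 3 * ρ) * G x :=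
    fun x => by
    have h3 := mul_nonneg hρ0 (hG0 x).le
    linarith [hmom₁ x]
  have hmem₁ : θ₁ ∈ paramSpace α ε1 q a A ε := by
    refine singleScaleModel_mem_paramSpace hε0 hε1 hσ _ hk0 hk1 (by rw [Real.sqrt_sq ha.le]) hεle
      (lintegral_absMoment_le hv (by linarith) hq hε0.le hε1.le (by linarith) hmom₁' hA)
      (rapidDecay_perturbedNormal c d r hT0) ?_
    simpa only [add_zero] using rapidDecay_perturbedNormal c d r hT0
  have hmem₂ : θ₂ ∈ paramSpace α ε1 q a A ε := by
    refine singleScaleModel_mem_paramSpace hε0 hε1 _ _ hg0 hg1 (Real.le_sqrt_of_sq_le (by linarith))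
      hεle (lintegral_absMoment_le hv (by linarith) hq hε0.le hε1.le (by linarith) hmom₂ hA)
      (rapidDecay_normalDensity 0 h1r) ?_
    have e : ∀ u, normalDensity 0 √(1 - r) (u + d) = normalDensity (-d) √(1 - r) u := fun u => by
      rw [normalDensity_sqrt h1r, normalDensity_sqrt h1r, sub_zero, sub_neg_eq_add]
    simp_rw [e]
    exact rapidDecay_normalDensity (-d) h1r
  have hdint : Integrable θ₂.density := by
    rw [funext hf₂]
    exact ((integrable_normalDensity (Real.sqrt_pos.2 hvr)).const_mul _).add
      ((integrable_normalDensity (Real.sqrt_pos.2 hw)).const_mul _)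
  have hdone : ∫ x, θ₂.density x = 1 := by
    simp_rw [hf₂]
    rw [integral_add ((integrable_normalDensity (Real.sqrt_pos.2 hvr)).const_mul _)
      ((integrable_normalDensity (Real.sqrt_pos.2 hw)).const_mul _), integral_const_mul,
      integral_const_mul, integral_normalDensity (Real.sqrt_pos.2 hvr),
      integral_normalDensity (Real.sqrt_pos.2 hw)]
    ring
  have hGi : Integrable fun x => y * G x :=
    (integrable_normalDensity (Real.sqrt_pos.2 hw)).const_mul _
  have hy0 : 0 ≤ y := by rw [hy]; positivity
  have key : ∀ g : EligibleModel → ℝ, ENNReal.ofReal ((g θ₁ - g θ₂) ^ 2 / 8)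
      ≤ minimaxRisk n (paramSpace α ε1 q a A ε) g := fun g => by
    -- The common minorant: the second density lowered by the bound y G on the difference, which
    -- costs mass exactly y.
    refine two_point_lower_bound hmem₁ hmem₂ (m := fun x => θ₂.density x - y * G x)
      (hdint.sub hGi) (fun x => ?_) (fun x => ?_) (y := y) (by linarith) hny ?_
    · linarith [(abs_le.1 (hdiff x)).1]
    · linarith [mul_nonneg hy0 (hG0 x).le]
    · rw [integral_sub hdint hGi, hdone, integral_const_mul,
        integral_normalDensity (Real.sqrt_pos.2 hw), mul_one]
  constructor
  · have h := key fun θ => θ.σ0 ^ 2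
    have e : (√(a ^ 2) ^ 2 - √(a ^ 2 + r) ^ 2) ^ 2 / 8 = r ^ 2 / 8 := by
      rw [Real.sq_sqrt hv.le, Real.sq_sqrt hvr.le]; ring
    rw [← e]
    exact h
  · have h := key fun θ => θ.u0
    have e : (0 - d) ^ 2 / 8 = d ^ 2 / 8 := by ring
    rw [← e]
    exact h

/-- Turns the strict inequality assumed of A into room for the perturbation. -/
lemma exists_pos_one_add_mul_le {x y : ℝ} (hx : 0 ≤ x) (hxy : x < y) :
    ∃ ρ, 0 < ρ ∧ ρ ≤ 1 / 2 ∧ (1 + 3 * ρ) * x ≤ y := by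
  refine ⟨min (1 / 2) ((y - x) / (3 * (x + 1))), ?_, min_le_left _ _, ?_⟩
  · exact lt_min (by norm_num) (div_pos (by linarith) (by positivity))
  · have h : min (1 / 2) ((y - x) / (3 * (x + 1))) * (3 * x) ≤ y - x := by
      calc _ ≤ (y - x) / (3 * (x + 1)) * (3 * x) := by gcongr; exact min_le_right _ _
        _ = (y - x) * (x / (x + 1)) := by field_simp
        _ ≤ (y - x) * 1 := by
          have : x / (x + 1) ≤ 1 := (div_le_one (by linarith)).2 (by linarith)
          have : 0 ≤ y - x := by linarith
          gcongr
        _ = _ := mul_one _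
    linarith

end NullDensity

theorem corollary2p1 (α β ε0 q a A : ℝ) (hα : 2 < α) (hβ0 : 0 ≤ β) (hβ : β < 1 / 2)
    (hε0 : 0 < ε0) (hε1 : ε0 < 1) (hq : 0 < q) (ha : 0 < a)
    (hA : Real.sqrt (a ^ 2 + 1) * NullDensity.normalAbsMoment q ^ (1 / q) < A) :
    ∃ C : ℝ, 0 < C ∧
      ∀ η : ℕ → ℝ, (∀ n : ℕ, 1 ≤ n → ε0 * (n : ℝ) ^ (-β) ≤ η n ∧ η n ≤ ε0) →
        ENNReal.ofReal C ≤ liminf (fun n : ℕ =>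
            ENNReal.ofReal ((η n ^ 2)⁻¹ * Real.log n ^ (α + 2)) *
              NullDensity.minimaxRiskVar n (NullDensity.paramSpace α ε0 q a A (η n))) atTop ∧
        ENNReal.ofReal C ≤ liminf (fun n : ℕ =>
            ENNReal.ofReal ((η n ^ 2)⁻¹ * Real.log n ^ (α + 1)) *
              NullDensity.minimaxRiskMean n (NullDensity.paramSpace α ε0 q a A (η n))) atTop := by
  obtain ⟨K, hK, l, hl, hrisk⟩ := NullDensity.exists_minimaxRisk_lower_bound ha
  have hM := NullDensity.normalAbsMoment_nonneg q
  have hmom : √(a ^ 2 + 1) ^ q * NullDensity.normalAbsMoment q < A ^ q := by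
    have := Real.rpow_lt_rpow (by positivity) hA hq
    rwa [Real.mul_rpow (by positivity) (by positivity), ← Real.rpow_mul hM,
      one_div_mul_cancel hq.ne', Real.rpow_one] at this
  obtain ⟨ρ, hρ0, hρ, hρA⟩ := NullDensity.exists_pos_one_add_mul_le (by positivity) hmom
  -- This choice gives exp(-lT²) = n⁻² at T² = B log n, so n times the error tends to zero.
  set B := 2 / l with hB
  have hB0 : 0 < B := by positivity
  -- the squared bandwidth
  set X : ℕ → ℝ := fun n => B * Real.log n with hX
  have hXtop : Tendsto X atTop atTop :=
    (Real.tendsto_log_atTop.comp tendsto_natCast_atTop_atTop).const_mul_atTop hB0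
  have hexp : ∀ n : ℕ, 1 ≤ n → Real.exp (-l * X n) = ((n : ℝ) ^ 2)⁻¹ := fun n hn => by
    have hn0 : (0 : ℝ) < n := by exact_mod_cast hn
    rw [show -l * X n = -(2 * Real.log n) by simp only [hX, hB]; field_simp, Real.exp_neg,
      two_mul, Real.exp_add, Real.exp_log hn0, sq]
  -- 24 = 6 · 4 is the coefficient of dT² in the smallness condition; it also covers the coefficient
  -- 18 = 6 · 3 of rT³.
  have hdecay : ∀ᶠ n in atTop, X n ^ ((1 - α) / 2) * 24 ≤ ρ := by
    have h1 : Tendsto (fun n => X n ^ (-((α - 1) / 2)) * 24) atTop (𝓝 (0 * 24)) :=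
      ((tendsto_rpow_neg_atTop (by linarith)).comp hXtop).mul_const 24
    rw [zero_mul] at h1
    filter_upwards [h1.eventually_le_const hρ0] with n hn
    rwa [show (1 - α) / 2 = -((α - 1) / 2) by ring]
  have hev : ∀ᶠ n : ℕ in atTop, 1 ≤ n ∧ 1 ≤ X n ∧ X n ^ ((1 - α) / 2) * 24 ≤ ρ ∧
      2 * K / ρ ≤ n ∧ 4 * K ≤ n := by
    filter_upwards [eventually_ge_atTop 1, hXtop.eventually_ge_atTop 1, hdecay,
      tendsto_natCast_atTop_atTop.eventually_ge_atTop (2 * K / ρ),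
      tendsto_natCast_atTop_atTop.eventually_ge_atTop (4 * K)] with n h1 h2 h3 h4 h5
    exact ⟨h1, h2, h3, h4, h5⟩
  refine ⟨min (B ^ (-(α + 2)) / 8) (B ^ (-(α + 1)) / 8), by positivity, fun η hη => ?_⟩
  have main : ∀ n : ℕ, 1 ≤ n → 1 ≤ X n → X n ^ ((1 - α) / 2) * 24 ≤ ρ → 2 * K / ρ ≤ n →
      4 * K ≤ n → ∀ d r : ℝ, 0 ≤ d → 0 ≤ r →
      6 * (4 * d * √(X n) + 3 * r * √(X n) ^ 2) * √(X n) ≤ η n * (X n ^ ((1 - α) / 2) * 24) →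
      ENNReal.ofReal (r ^ 2 / 8)
          ≤ NullDensity.minimaxRiskVar n (NullDensity.paramSpace α ε0 q a A (η n)) ∧
        ENNReal.ofReal (d ^ 2 / 8)
          ≤ NullDensity.minimaxRiskMean n (NullDensity.paramSpace α ε0 q a A (η n)) := by
    intro n hn hX1 hdec hn2 hn4 d r hd hr hsmall
    have hn0 : (0 : ℝ) < n := by exact_mod_cast hn
    have hn1 : (1 : ℝ) ≤ n := by exact_mod_cast hn
    have hη0 : 0 < η n := lt_of_lt_of_le (by positivity) (hη n hn).1
    have hT2 : √(X n) ^ 2 = X n := Real.sq_sqrt (by linarith)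
    refine hrisk α q A ε0 (η n) d r √(X n) ρ _ n hq hη0 ((hη n hn).2.trans_lt hε1) (hη n hn).2 hd hr
      (Real.one_le_sqrt.2 hX1) hρ ?_ rfl ?_ ?_ hρA
    · refine hsmall.trans ?_
      rw [mul_comm ρ]
      gcongr
    · rw [hT2, hexp n hn, ← div_eq_mul_inv, ← mul_div_assoc, div_le_iff₀ (by positivity)]
      rw [div_le_iff₀ hρ0] at hn2
      nlinarith
    · rw [hT2, hexp n hn]
      field_simp
      linarith
  -- With separation η T^{-p} the normalised bound is independent of n; p = α + 2 serves the
  -- variance and p = α + 1 the mean.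
  have rate : ∀ n : ℕ, 1 ≤ n → 1 ≤ X n → ∀ p : ℝ,
      (η n ^ 2)⁻¹ * Real.log n ^ p * ((η n * X n ^ (-(p / 2))) ^ 2 / 8) = B ^ (-p) / 8 := by
    intro n hn hX1 p
    have hn0 : (0 : ℝ) < n := by exact_mod_cast hn
    have hη0 : 0 < η n := lt_of_lt_of_le (by positivity) (hη n hn).1
    have hX0 : 0 < X n := by linarith
    have hlog : 0 < Real.log n := pos_of_mul_pos_right hX0 hB0.le
    rw [mul_pow, ← Real.rpow_natCast (X n ^ _), ← Real.rpow_mul hX0.le,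
      show -(p / 2) * ((2 : ℕ) : ℝ) = -p by push_cast; ring, hX,
      Real.mul_rpow hB0.le hlog.le, Real.rpow_neg hlog.le]
    have := (Real.rpow_pos_of_pos hlog p).ne'
    field_simp
  constructor
  · refine le_liminf_of_le (by isBoundedDefault) ?_
    filter_upwards [hev] with n ⟨hn, hX1, hdec, hn2, hn4⟩
    have hη0 : 0 < η n := lt_of_lt_of_le (by positivity) (hη n hn).1
    have hX0 : 0 < X n := by linarith
    -- For the variance only r is moved and d = 0.
    have h := (main n hn hX1 hdec hn2 hn4 0 (η n * X n ^ (-((α + 2) / 2))) le_rfl (by positivity) (by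
      have e : X n ^ (-((α + 2) / 2)) * √(X n) ^ 2 * √(X n) = X n ^ ((1 - α) / 2) := by
        rw [Real.sq_sqrt hX0.le, Real.sqrt_eq_rpow, ← Real.rpow_add_one hX0.ne',
          ← Real.rpow_add hX0]
        congr 1; ring
      rw [← e]
      have : 0 ≤ η n * (X n ^ (-((α + 2) / 2)) * √(X n) ^ 2 * √(X n)) := by positivity
      linarith)).1
    calc ENNReal.ofReal (min (B ^ (-(α + 2)) / 8) (B ^ (-(α + 1)) / 8))
        ≤ ENNReal.ofReal (B ^ (-(α + 2)) / 8) := ENNReal.ofReal_le_ofReal (min_le_left _ _)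
      _ = _ := by
        rw [← rate n hn hX1 (α + 2), ENNReal.ofReal_mul
          (mul_nonneg (by positivity) (Real.rpow_nonneg (Real.log_natCast_nonneg n) _))]
      _ ≤ _ := mul_le_mul_right h _
  · refine le_liminf_of_le (by isBoundedDefault) ?_
    filter_upwards [hev] with n ⟨hn, hX1, hdec, hn2, hn4⟩
    have hη0 : 0 < η n := lt_of_lt_of_le (by positivity) (hη n hn).1
    have hX0 : 0 < X n := by linarith
    -- For the mean only d is moved and r = 0.
    have h := (main n hn hX1 hdec hn2 hn4 (η n * X n ^ (-((α + 1) / 2))) 0 (by positivity) le_rfl (by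
      have e : X n ^ (-((α + 1) / 2)) * √(X n) * √(X n) = X n ^ ((1 - α) / 2) := by
        rw [mul_assoc, Real.mul_self_sqrt hX0.le, ← Real.rpow_add_one hX0.ne']
        congr 1; ring
      rw [← e]
      linarith)).2
    calc ENNReal.ofReal (min (B ^ (-(α + 2)) / 8) (B ^ (-(α + 1)) / 8))
        ≤ ENNReal.ofReal (B ^ (-(α + 1)) / 8) := ENNReal.ofReal_le_ofReal (min_le_right _ _)
      _ = _ := by
        rw [← rate n hn hX1 (α + 1), ENNReal.ofReal_mul
          (mul_nonneg (by positivity) (Real.rpow_nonneg (Real.log_natCast_nonneg n) _))]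
      _ ≤ _ := mul_le_mul_right h _
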